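/- **Theorem 8.6.** Let $X$ be a connected simple graph with vertex set $VX$ (finite or infinite, not necessarily locally finite). *Notation.* For $C\subseteq VX$ let $NC$ be the set of vertices outside $C$ adjacent to a vertex of $C$, and $C^*=VX\setminus(C\cup NC)$. The *corners* of $C,D$ are $C\cap D$, $C\cap D^*$, $C^*\cap D$, $C^*\cap D^*$; the corner $S\cap T$ (with $S\in\{C,C^*\}$, $T\in\{D,D^*\}$) has the *adjacent links* $S\cap ND$ and $T\cap NC$; $C\cap D$ is *opposite* to $C^*\cap D^*$, and $C\cap D^*$ to $C^*\cap D$. A set of vertices is *connected* if it induces a connected subgraph; components of a set of vertices are its maximal non-empty connected subsets. A *cut system* is a family $\mathcal C$ of non-empty connected sets $C$ of vertices with $NC$ finite and $C^{**}=C$ such that, for all $C,D\in\mathcal C$: (A1) if two opposite corners of $C,D$ each contain an element of $\mathcal C$, then every component of these corners that contains an element of $\mathcal C$ is in $\mathcal C$; (A2) there are two opposite corners of $C,D$ each of which contains an element of $\mathcal C$. It is *thin* if $|NC|$ is the same for all $C\in\mathcal C$. Two sets $C,D$ are *nested with respect to* $\mathcal C$ if some corner of $C,D$ contains no element of $\mathcal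 C$ and has two empty adjacent links; a cut system $\mathcal C$ is *nested* if any two of its elements are nested with respect to $\mathcal C$. For $C\in\mathcal C$ let $\mu_{\mathcal C}(C)$ be the number of $D\in\mathcal C$ such that $C,D$ are not nested with respect to $\mathcal C$. A *vertex end* is an equivalence class of rays (one-way infinite paths), two rays being equivalent if there is no connected $C$ with $NC$ finite such that one of them is eventually in $C$ and the other eventually in $C^*$. For $k\ge 0$, a set $Y\subseteq VX$ is *$k$-inseparable* if $|Y|\ge k+1$ and for every $C\subseteq VX$ with $|NC|\le k$ either $Y\subseteq C\cup NC$ or $Y\subseteq C^*\cup NC$. For each $k$ let $\Omega_k$ be the set of vertex ends of $X$, or the set of $k$-inseparable sets, or the union of the two (one of these three choices, fixed throughout). An end is on the side $S\in\{C,C^*\}$ of $C$ if its rays are eventually in $S$; a set $Y$ is on the side $S$ of $C$ if $Y\subseteq S\cup NC$ and $Y\not\subseteq NC$. A set $C$ *separates* $\omega_1,\omega_2$ if one of them is on the side $C$ and the other on the side $C^*$. Let $\kappa$ be the smallest positive integer $k$ such that some $C\subseteq VX$ with $|NC|=k$ separates two elements of $\Omega_k$, and put $\Omega=\Omega_\kappa$.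 The *$\Omega$-cut system* $\mathcal C=\mathcal C(X)$ is the set of all non-empty connected $A\subseteq VX$ with $A^{**}=A$ and $|NA|=\kappa$ that separate a pair of elements of $\Omega$. (If there is no such $k$, then $\mathcal C=\emptyset$, $\kappa$ is read as $0$, and the claims below are trivial.) Let $\mathcal N=\mathcal N(X)$ be the set of all $C\in\mathcal C$ for which there are $\omega_1,\omega_2\in\Omega$ such that $C$ separates $\omega_1,\omega_2$ and $\mu_{\mathcal C}(C)\le\mu_{\mathcal C}(D)$ for every $D\in\mathcal C$ that separates $\omega_1,\omega_2$. *Claim.* $\mathcal C$ is a thin cut system, and $\mathcal N$ is a subsystem of $\mathcal C$ with the following properties: 1. $\mathcal N\subseteq\mathcal C$, and $\mathcal N$ is a nested cut system; moreover any two elements of $\mathcal N$ are nested with respect to $\mathcal C$. 2. $\mathcal N$ is invariant under $\mathrm{Aut}(X)$; more generally, every isomorphism $f:X\to Y$ of graphs maps $\mathcal N(X)$ onto $\mathcal N(Y)$ (for the same choice of the type of $\Omega$). 3. If $\omega_1,\omega_2\in\Omega$ are separated by some cut in $\mathcal C$, then they are separated by some cut in $\mathcal N$. -/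

import Mathlib

open Set Filter

universe u

namespace VertexCuts

variable {V : Type u}

section Cuts

/-- The boundary `NC`: the vertices outside `C` that are adjacent to a vertex of `C`. -/
def boundary (X : SimpleGraph V) (C : Set V) : Set V :=
  {v | v ∉ C ∧ ∃ w ∈ C, X.Adj w v}

/-- The star-complement `C^* = VX \ (C ∪ NC)`. -/
def starCompl (X : SimpleGraph V) (C : Set V) : Set V :=
  (C ∪ boundary X C)ᶜ

/-- `K` is a component of the set of vertices `A`: a maximal non-empty connected subset. -/
def IsComponent (X : SimpleGraph V) (A K : Set V) : Prop :=
  Maximal (fun S : Set V => S ⊆ A ∧ (X.induce S).Connected) K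

/-- `A` and `B` are opposite corners of `C` and `D`. -/
def OppositeCorners (X : SimpleGraph V) (C D A B : Set V) : Prop :=
  (A = C ∩ D ∧ B = starCompl X C ∩ starCompl X D) ∨
  (A = starCompl X C ∩ starCompl X D ∧ B = C ∩ D) ∨
  (A = C ∩ starCompl X D ∧ B = starCompl X C ∩ D) ∨
  (A = starCompl X C ∩ D ∧ B = C ∩ starCompl X D)

/-- The set `A` contains an element of the family `𝒞`. -/
def ContainsCut (𝒞 : Set (Set V)) (A : Set V) : Prop :=
  ∃ E ∈ 𝒞, E ⊆ A

/-- Cut systems: families of non-empty connected sets with finite boundaries and `C^** = C`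
that satisfy the axioms (A1) and (A2). -/
structure IsCutSystem (X : SimpleGraph V) (𝒞 : Set (Set V)) : Prop where
  connected : ∀ C ∈ 𝒞, (X.induce C).Connected
  finite_boundary : ∀ C ∈ 𝒞, (boundary X C).Finite
  star_star : ∀ C ∈ 𝒞, starCompl X (starCompl X C) = C
  /-- (A1); since `OppositeCorners` is symmetric in `A` and `B`, it speaks about the
  components of both corners. -/
  axiom_one : ∀ C ∈ 𝒞, ∀ D ∈ 𝒞, ∀ A B : Set V, OppositeCorners X C D A B →
    ContainsCut 𝒞 A → ContainsCut 𝒞 B →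
    ∀ K : Set V, IsComponent X A K → ContainsCut 𝒞 K → K ∈ 𝒞
  /-- (A2) -/
  axiom_two : ∀ C ∈ 𝒞, ∀ D ∈ 𝒞, ∃ A B : Set V, OppositeCorners X C D A B ∧
    ContainsCut 𝒞 A ∧ ContainsCut 𝒞 B

/-- A thin cut system: a cut system all of whose separators have the same (hence the smallest)
number of vertices. -/
def IsThinCutSystem (X : SimpleGraph V) (𝒞 : Set (Set V)) : Prop :=
  IsCutSystem X 𝒞 ∧ ∃ k : ℕ, ∀ C ∈ 𝒞, (boundary X C).encard = k

/-- For `S ∈ {C, C^*}` and `T ∈ {D, D^*}`: the corner `S ∩ T` of `C` and `D` is isolated, i.e. it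
contains no element of `𝒞` and its two adjacent links `S ∩ ND` and `T ∩ NC` are empty. -/
def IsIsolatedCorner (X : SimpleGraph V) (𝒞 : Set (Set V)) (C D S T : Set V) : Prop :=
  ¬ ContainsCut 𝒞 (S ∩ T) ∧ S ∩ boundary X D = ∅ ∧ T ∩ boundary X C = ∅

/-- `C` and `D` are nested with respect to the cut system `𝒞`: they have an isolated corner. -/
def Nested (X : SimpleGraph V) (𝒞 : Set (Set V)) (C D : Set V) : Prop :=
  IsIsolatedCorner X 𝒞 C D C D ∨
  IsIsolatedCorner X 𝒞 C D C (starCompl X D) ∨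
  IsIsolatedCorner X 𝒞 C D (starCompl X C) D ∨
  IsIsolatedCorner X 𝒞 C D (starCompl X C) (starCompl X D)

/-- A nested cut system: a cut system whose cuts are pairwise nested. -/
def IsNestedCutSystem (X : SimpleGraph V) (𝒞 : Set (Set V)) : Prop :=
  IsCutSystem X 𝒞 ∧ ∀ C ∈ 𝒞, ∀ D ∈ 𝒞, Nested X 𝒞 C D

/-- `μ(C)`: the number of cuts in `𝒞` with which `C` is not nested. -/
noncomputable def mu (X : SimpleGraph V) (𝒞 : Set (Set V)) (C : Set V) : ℕ∞ :=
  {D ∈ 𝒞 | ¬ Nested X 𝒞 C D}.encard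

end Cuts

section Ends

/-- A ray: a sequence of distinct vertices, consecutive ones being adjacent. -/
structure Ray (X : SimpleGraph V) where
  toFun : ℕ → V
  injective : Function.Injective toFun
  adj : ∀ n, X.Adj (toFun n) (toFun (n + 1))

/-- From some index on, the ray `r` lies in `S`. -/
def Ray.EventuallyIn {X : SimpleGraph V} (r : Ray X) (S : Set V) : Prop :=
  ∀ᶠ n in atTop, r.toFun n ∈ S

/-- A vertex cut: a connected set of vertices with finite boundary. -/
def IsVertexCut (X : SimpleGraph V) (C : Set V) : Prop :=
  (X.induce C).Connected ∧ (boundary X C).Finite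

/-- One of the rays is eventually in `C`, the other one is eventually in `C^*`. -/
def SeparatesRays (X : SimpleGraph V) (C : Set V) (r s : Ray X) : Prop :=
  (r.EventuallyIn C ∧ s.EventuallyIn (starCompl X C)) ∨
  (s.EventuallyIn C ∧ r.EventuallyIn (starCompl X C))

theorem Ray.not_eventuallyIn_both {X : SimpleGraph V} (r : Ray X) (C : Set V)
    (h₁ : r.EventuallyIn C) (h₂ : r.EventuallyIn (starCompl X C)) : False := by
  obtain ⟨n, h, h'⟩ := (h₁.and h₂).exists
  exact h' (Or.inl h)

theorem Ray.eventuallyIn_or {X : SimpleGraph V} (r : Ray X) (C : Set V)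
    (hC : (boundary X C).Finite) :
    r.EventuallyIn C ∨ r.EventuallyIn (starCompl X C) := by
  have h : ∀ᶠ n in atTop, r.toFun n ∉ boundary X C := by
    have := r.injective.tendsto_cofinite.eventually hC.compl_mem_cofinite
    rwa [Nat.cofinite_eq_atTop] at this
  obtain ⟨m, hm⟩ := eventually_atTop.1 h
  by_cases h0 : r.toFun m ∈ C
  · left
    refine eventually_atTop.2 ⟨m, fun n hn => ?_⟩
    induction n, hn using Nat.le_induction with
    | base => exact h0
    | succ n hn ih =>
      by_contra hc
      exact hm (n + 1) (by omega) ⟨hc, _, ih, r.adj n⟩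
  · right
    refine eventually_atTop.2 ⟨m, fun n hn => ?_⟩
    have key : r.toFun n ∉ C := by
      induction n, hn using Nat.le_induction with
      | base => exact h0
      | succ n hn ih =>
        intro hc
        exact hm n hn ⟨ih, _, hc, (r.adj n).symm⟩
    rintro (h1 | h1)
    · exact key h1
    · exact hm n hn h1

/-- Two rays are equivalent if no vertex cut separates them. -/
def raySetoid (X : SimpleGraph V) : Setoid (Ray X) where
  r r s := ∀ C : Set V, IsVertexCut X C → ¬ SeparatesRays X C r s
  iseqv :=
    { refl := by
        rintro r C - (⟨h₁, h₂⟩ | ⟨h₁, h₂⟩) <;> exact r.not_eventuallyIn_both C h₁ h₂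
      symm := fun h C hC hs => h C hC (Or.symm hs)
      trans := by
        rintro r s t hrs hst C hC (⟨h₁, h₂⟩ | ⟨h₁, h₂⟩)
        · rcases s.eventuallyIn_or C hC.2 with h | h
          · exact hst C hC (Or.inl ⟨h, h₂⟩)
          · exact hrs C hC (Or.inl ⟨h₁, h⟩)
        · rcases s.eventuallyIn_or C hC.2 with h | h
          · exact hrs C hC (Or.inr ⟨h, h₂⟩)
          · exact hst C hC (Or.inr ⟨h₁, h⟩) }

/-- The vertex ends of `X`. -/
def VertexEnd (X : SimpleGraph V) : Type u :=
  Quotient (raySetoid X)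

/-- Every ray of the end `e` is eventually in `S`. -/
def VertexEnd.LiesIn {X : SimpleGraph V} (e : VertexEnd X) (S : Set V) : Prop :=
  ∀ r : Ray X, Quotient.mk (raySetoid X) r = e → r.EventuallyIn S

end Ends

section Omega

/-- A `k`-inseparable set: at least `k + 1` vertices, not split by any `C` with `|NC| ≤ k`. -/
def IsInseparable (X : SimpleGraph V) (k : ℕ) (Y : Set V) : Prop :=
  ((k + 1 : ℕ) : ℕ∞) ≤ Y.encard ∧
  ∀ C : Set V, (boundary X C).encard ≤ k →
    Y ⊆ C ∪ boundary X C ∨ Y ⊆ starCompl X C ∪ boundary X C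

/-- The three choices for the set `Ω`: the vertex ends, the inseparable sets, or both. -/
inductive OmegaKind
  | ends
  | inseparable
  | both

/-- The set `Ω`, where inseparable means `k`-inseparable. Its elements are ends (`Sum.inl`) and
sets of vertices (`Sum.inr`). -/
def Omega (X : SimpleGraph V) : OmegaKind → ℕ → Set (VertexEnd X ⊕ Set V)
  | .ends, _ => range Sum.inl
  | .inseparable, k => Sum.inr '' {Y | IsInseparable X k Y}
  | .both, k => range Sum.inl ∪ Sum.inr '' {Y | IsInseparable X k Y}

/-- For `S ∈ {C, C^*}`: the end or set of vertices `ω` is on the side `S` of `C`. For an end this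
means that its rays are eventually in `S`; for a set `Y` that `Y ⊆ S ∪ NC` but not `Y ⊆ NC`. -/
def OnSide (X : SimpleGraph V) (C S : Set V) : VertexEnd X ⊕ Set V → Prop
  | .inl e => e.LiesIn S
  | .inr Y => Y ⊆ S ∪ boundary X C ∧ ¬ Y ⊆ boundary X C

/-- `C` separates `ω₁` and `ω₂`. -/
def Separates (X : SimpleGraph V) (C : Set V) (ω₁ ω₂ : VertexEnd X ⊕ Set V) : Prop :=
  (OnSide X C C ω₁ ∧ OnSide X C (starCompl X C) ω₂) ∨
  (OnSide X C C ω₂ ∧ OnSide X C (starCompl X C) ω₁)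

/-- The smallest positive integer `k` such that two elements of `Ω` (formed with `k`-inseparable
sets) are separated by some `C` with `|NC| = k`. (If there is no such `k` then the value is `0`,
and no set of vertices of a connected graph is in `omegaCuts`.) -/
noncomputable def kappa (X : SimpleGraph V) (t : OmegaKind) : ℕ :=
  sInf {k : ℕ | 0 < k ∧ ∃ C : Set V, (boundary X C).encard = k ∧
    ∃ ω₁ ∈ Omega X t k, ∃ ω₂ ∈ Omega X t k, Separates X C ω₁ ω₂}

/-- The `Ω`-cut system: all non-empty connected `A` with `A^** = A` that are thin, i.e.
`|NA| = κ`, and separate a pair of elements of `Ω`. -/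
def omegaCuts (X : SimpleGraph V) (t : OmegaKind) : Set (Set V) :=
  {A | (X.induce A).Connected ∧ starCompl X (starCompl X A) = A ∧
    (boundary X A).encard = kappa X t ∧
    ∃ ω₁ ∈ Omega X t (kappa X t), ∃ ω₂ ∈ Omega X t (kappa X t), Separates X A ω₁ ω₂}

/-- `C` is optimally nested with respect to `ω₁`, `ω₂`: among the cuts in `𝒞` that separate
`ω₁` and `ω₂` it has the smallest value of `μ`. -/
def IsOptimallyNested (X : SimpleGraph V) (𝒞 : Set (Set V)) (ω₁ ω₂ : VertexEnd X ⊕ Set V)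
    (C : Set V) : Prop :=
  C ∈ 𝒞 ∧ Separates X C ω₁ ω₂ ∧ ∀ D ∈ 𝒞, Separates X D ω₁ ω₂ → mu X 𝒞 C ≤ mu X 𝒞 D

/-- The canonical subsystem `𝒩` of the `Ω`-cut system: the cuts that are optimally nested with
respect to some pair of elements of `Ω`. -/
def canonicalCuts (X : SimpleGraph V) (t : OmegaKind) : Set (Set V) :=
  {C | ∃ ω₁ ∈ Omega X t (kappa X t), ∃ ω₂ ∈ Omega X t (kappa X t),
    IsOptimallyNested X (omegaCuts X t) ω₁ ω₂ C}

end Omega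

end VertexCuts

-- The points of `Ω`, ends or inseparable sets, enter the cut arguments only through the properties
-- in `IsProfile`: each point chooses a side of every set with at most `κ` boundary vertices, the
-- choices are compatible with corners and components, and no two points are separated by fewer than
-- `κ` vertices.
--
-- Counting carries the thin cut system. Two separators always have a pair of opposite corners that
-- contain points (`exists_opposite`). The frames of these corners have at least `κ` vertices each
-- and total size `|NC| + |ND| = 2κ`, so both have exactly `κ` (`links_eq`). The corners are
-- therefore separators again, which gives (A1) and (A2). The same count pairs the links into equal
-- ones, so nestedness fails exactly when all four links are non-empty (`nested_iff`). For a fixed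
-- other separator, such crossing depends only on the boundary (`crosses_congr`).
--
-- Each cut crosses only finitely many cuts, because only finitely many tight separators of size `κ`
-- separate two given vertices. Hence `μ` is finite, and uncrossing makes sense: if `C` and `D`
-- cross, suitable components `A`, `B` of two opposite corners that contain points satisfy `μ(A) +
-- μ(B) < μ(C) + μ(D)` (`crossSet_submodular`). If `C` and `D` were optimal for the pairs `i, j` and
-- `k, l`, the positions of the four points would always allow a choice of corners contradicting
-- optimality (`not_crosses_of_optimal`).
--
-- For optimal cuts to form a cut system, corner components must be optimal. Since the cuts do not
-- cross, a component of a corner is already a component of a side of `C` or of `D`. It has the same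
-- boundary and hence the same `μ`. Either it still separates the original pair, or a side has two
-- components that are cuts; then nothing crosses that boundary and `μ = 0`
-- (`not_crosses_of_two_components`).
--
-- Property 3 follows from the well-ordering of `ℕ∞`, and invariance from transporting every notion
-- along isomorphisms.

universe v

namespace VertexCuts

variable {V : Type u} {X : SimpleGraph V} {A B C D K : Set V}

/-! ### Boundaries, star complements and frames of corners -/

section Basic

theorem mem_starCompl {v : V} : v ∈ starCompl X C ↔ v ∉ C ∧ v ∉ boundary X C := by
  simp [starCompl]

theorem boundary_starCompl_subset (X : SimpleGraph V) (C : Set V) :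
    boundary X (starCompl X C) ⊆ boundary X C := by
  rintro v ⟨hv, w, hw, hwv⟩
  by_contra h
  rw [mem_starCompl] at hv hw
  have hvC : v ∈ C := by tauto
  exact hw.2 ⟨hw.1, v, hvC, hwv.symm⟩

theorem disjoint_starCompl (X : SimpleGraph V) (C : Set V) : Disjoint C (starCompl X C) :=
  Set.disjoint_left.2 fun _ h h' => (mem_starCompl.1 h').1 h

theorem union_boundary_mono (h : A ⊆ B) : A ∪ boundary X A ⊆ B ∪ boundary X B := by
  rintro v (hv | ⟨-, w, hw, hwv⟩)
  · exact Or.inl (h hv)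
  · by_cases hvB : v ∈ B
    · exact Or.inl hvB
    · exact Or.inr ⟨hvB, w, h hw, hwv⟩

theorem starCompl_antitone (h : A ⊆ B) : starCompl X B ⊆ starCompl X A :=
  compl_subset_compl.2 (union_boundary_mono h)

theorem subset_star_star (X : SimpleGraph V) (C : Set V) :
    C ⊆ starCompl X (starCompl X C) := by
  intro v hv
  rw [mem_starCompl]
  exact ⟨fun h => (mem_starCompl.1 h).1 hv, fun h => (boundary_starCompl_subset X C h).1 hv⟩

theorem starCompl_union_boundary (X : SimpleGraph V) (C : Set V) :
    starCompl X C ∪ boundary X C = Cᶜ := by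
  ext v
  simp only [mem_union, mem_starCompl, mem_compl_iff]
  have : v ∈ boundary X C → v ∉ C := fun h => h.1
  tauto

/-- The corner `C ∩ D` is enclosed by its two adjacent links and the centre `NC ∩ ND`. -/
def frame (X : SimpleGraph V) (C D : Set V) : Set V :=
  (C ∩ boundary X D) ∪ (D ∩ boundary X C) ∪ (boundary X C ∩ boundary X D)

theorem boundary_inter_subset_frame (X : SimpleGraph V) (C D : Set V) :
    boundary X (C ∩ D) ⊆ frame X C D := by
  rintro v ⟨hv, w, ⟨hwC, hwD⟩, hwv⟩
  by_cases hC : v ∈ C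
  · exact Or.inl (Or.inl ⟨hC, fun h => hv ⟨hC, h⟩, w, hwD, hwv⟩)
  · by_cases hD : v ∈ D
    · exact Or.inl (Or.inr ⟨hD, hC, w, hwC, hwv⟩)
    · exact Or.inr ⟨⟨hC, w, hwC, hwv⟩, ⟨hD, w, hwD, hwv⟩⟩

theorem inter_union_frame (X : SimpleGraph V) (C D : Set V) :
    (C ∪ boundary X C) ∩ (D ∪ boundary X D) = C ∩ D ∪ frame X C D := by
  ext v
  simp only [frame, mem_union, mem_inter_iff]
  tauto

end Basic

/-! ### Connected sets and components -/

section Connected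

theorem exists_walk_of_induce_connected (h : (X.induce K).Connected) {x y : V} (hx : x ∈ K)
    (hy : y ∈ K) : ∃ p : X.Walk x y, ∀ v ∈ p.support, v ∈ K := by
  obtain ⟨p⟩ := h.preconnected ⟨x, hx⟩ ⟨y, hy⟩
  let f : X.induce K →g X := (SimpleGraph.Embedding.induce K).toHom
  suffices H : ∃ q : X.Walk (f ⟨x, hx⟩) (f ⟨y, hy⟩), ∀ v ∈ q.support, v ∈ K from H
  refine ⟨p.map f, fun v hv => ?_⟩
  rw [SimpleGraph.Walk.support_map, List.mem_map] at hv
  obtain ⟨w, -, rfl⟩ := hv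
  exact w.2

theorem exists_mem_support_boundary {x y : V} (p : X.Walk x y) (hx : x ∈ A) (hy : y ∉ A) :
    ∃ v ∈ p.support, v ∈ boundary X A := by
  obtain ⟨d, hd, h1, h2⟩ := p.exists_boundary_dart A hx hy
  exact ⟨d.snd, p.dart_snd_mem_support_of_mem_darts hd, h2, d.fst, h1, d.adj⟩

/-- A path inside `K` that leaves `A` would have to pass through `NA`. -/
theorem subset_of_disjoint_boundary (h : (X.induce K).Connected) {x : V} (hx : x ∈ K)
    (hxA : x ∈ A) (hd : Disjoint K (boundary X A)) : K ⊆ A := by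
  intro y hy
  by_contra hyA
  obtain ⟨p, hp⟩ := exists_walk_of_induce_connected h hx hy
  obtain ⟨v, hv, hvA⟩ := exists_mem_support_boundary p hxA hyA
  exact Set.disjoint_left.1 hd (hp v hv) hvA

theorem nonempty_of_induce_connected (h : (X.induce K).Connected) : K.Nonempty := by
  obtain ⟨x⟩ := h.nonempty
  exact ⟨x, x.2⟩

theorem induce_singleton_connected (X : SimpleGraph V) (x : V) :
    (X.induce ({x} : Set V)).Connected := by
  have : Nonempty ({x} : Set V) := ⟨⟨x, rfl⟩⟩
  refine ⟨fun a b => ?_⟩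
  rw [Subsingleton.elim a b]

theorem induce_insert_connected (h : (X.induce K).Connected) {v : V}
    (hv : v ∈ boundary X K) : (X.induce (insert v K)).Connected := by
  obtain ⟨-, w, hw, hwv⟩ := hv
  have h2 : insert v K = K ∪ {w, v} := by
    ext z
    simp only [mem_insert_iff, mem_union, mem_singleton_iff]
    constructor
    · tauto
    · rintro (h | rfl | h)
      · exact Or.inr h
      · exact Or.inr hw
      · exact Or.inl h
  rw [h2]
  exact SimpleGraph.induce_union_connected h.preconnected
    (SimpleGraph.induce_pair_connected_of_adj hwv).preconnected ⟨w, hw, by simp⟩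

theorem IsComponent.subset (h : IsComponent X A K) : K ⊆ A := h.prop.1

theorem IsComponent.connected (h : IsComponent X A K) : (X.induce K).Connected := h.prop.2

/-- A neighbour of `K` inside `A` could be added to `K`. Together with the converse
`isComponent_of_disjoint_boundary`, this replaces maximality by a condition on the boundary. -/
theorem IsComponent.disjoint_boundary (h : IsComponent X A K) : Disjoint A (boundary X K) := by
  rw [Set.disjoint_right]
  intro v hv hvA
  exact hv.1 (h.le_of_ge ⟨insert_subset hvA h.subset, induce_insert_connected h.connected hv⟩
    (subset_insert v K) (mem_insert v K))

theorem IsComponent.boundary_subset (h : IsComponent X A K) : boundary X K ⊆ boundary X A := by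
  rintro v hv
  exact ⟨fun hvA => Set.disjoint_right.1 h.disjoint_boundary hv hvA,
    hv.2.imp fun w hw => ⟨h.subset hw.1, hw.2⟩⟩

theorem isComponent_of_disjoint_boundary (hK : (X.induce K).Connected) (hA : K ⊆ A)
    (hd : Disjoint A (boundary X K)) : IsComponent X A K := by
  refine ⟨⟨hA, hK⟩, fun L hL hKL => ?_⟩
  obtain ⟨x, hx⟩ := nonempty_of_induce_connected hK
  exact subset_of_disjoint_boundary hL.2 (hKL hx) hx (hd.mono_left hL.1)

theorem exists_isComponent {x : V} (hx : x ∈ A) : ∃ K, IsComponent X A K ∧ x ∈ K := by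
  let S : Set (Set V) := {T | T ⊆ A ∧ (X.induce T).Connected ∧ x ∈ T}
  have hS : S.Nonempty := ⟨{x}, singleton_subset_iff.2 hx, induce_singleton_connected X x, rfl⟩
  have hc : (X.induce (⋃₀ S)).Connected :=
    SimpleGraph.induce_sUnion_connected_of_pairwise_not_disjoint hS
      (fun hs ht => ⟨x, hs.2.2, ht.2.2⟩) (fun hs => hs.2.1)
  have hx' : x ∈ ⋃₀ S := by
    obtain ⟨T, hT⟩ := hS
    exact ⟨T, hT, hT.2.2⟩
  refine ⟨⋃₀ S, ⟨⟨sUnion_subset fun T hT => hT.1, hc⟩, fun L hL hle => ?_⟩, hx'⟩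
  exact subset_sUnion_of_mem ⟨hL.1, hL.2, hle hx'⟩

theorem IsComponent.eq_of_mem {L : Set V} (h : IsComponent X A K) (h' : IsComponent X A L) {x : V}
    (hx : x ∈ K) (hx' : x ∈ L) : K = L := by
  apply Subset.antisymm
  · exact subset_of_disjoint_boundary h.connected hx hx'
      (h'.disjoint_boundary.mono_left h.subset)
  · exact subset_of_disjoint_boundary h'.connected hx' hx
      (h.disjoint_boundary.mono_left h'.subset)

theorem IsComponent.disjoint_of_ne {L : Set V} (h : IsComponent X A K) (h' : IsComponent X A L)
    (hne : K ≠ L) : Disjoint K L :=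
  Set.disjoint_left.2 fun _ hx hx' => hne (h.eq_of_mem h' hx hx')

theorem isComponent_self (h : (X.induce C).Connected) : IsComponent X C C :=
  ⟨⟨Subset.rfl, h⟩, fun _ hL _ => hL.1⟩

/-- If `S` does not meet the boundary of `T`, then the components of `S ∩ T` are components of
`S`. -/
theorem IsComponent.of_inter {S T : Set V} (h : IsComponent X (S ∩ T) K)
    (hd : S ∩ boundary X T = ∅) : IsComponent X S K := by
  refine isComponent_of_disjoint_boundary h.connected (h.subset.trans inter_subset_left) ?_
  rw [Set.disjoint_left]
  intro v hvS hv
  have hvT : v ∈ T := by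
    by_contra hvT
    obtain ⟨w, hw, hwv⟩ := hv.2
    exact (hd ▸ (⟨hvS, hvT, w, (h.subset hw).2, hwv⟩ : v ∈ S ∩ boundary X T) : v ∈ (∅ : Set V))
  exact Set.disjoint_left.1 h.disjoint_boundary ⟨hvS, hvT⟩ hv

end Connected

/-! ### Finiteness of the tight separators of two vertices -/

section TightSeparators

/-- `S` is a tight separator of `x` and `y`: it is the boundary of two connected sets, one of
which contains `x` but not `y`, and the other one contains `y`. -/
def IsTightSeparator (X : SimpleGraph V) (x y : V) (S : Set V) : Prop :=
  ∃ P Q : Set V, (X.induce P).Connected ∧ (X.induce Q).Connected ∧ x ∈ P ∧ y ∉ P ∧ y ∈ Q ∧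
    boundary X P = S ∧ boundary X Q = S

/-- Induction on the number of vertices outside the prescribed part `F`. One separator `S₀` yields a
path from `x` to `y` that avoids `F`; every other separator contains one of the finitely many
vertices of this path, and that vertex can be added to `F`. -/
theorem finite_isTightSeparator_of_subset (X : SimpleGraph V) (x y : V) (n : ℕ) (F : Set V) :
    {S | F ⊆ S ∧ (S \ F).encard = n ∧ IsTightSeparator X x y S}.Finite := by
  induction n generalizing F with
  | zero =>
    refine (finite_singleton F).subset ?_
    rintro S ⟨hFS, hS, -⟩
    rw [Nat.cast_zero, encard_eq_zero, sdiff_eq_empty] at hS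
    exact Subset.antisymm hS hFS
  | succ n ih =>
    rcases Set.eq_empty_or_nonempty
      {S | F ⊆ S ∧ (S \ F).encard = (n + 1 : ℕ) ∧ IsTightSeparator X x y S} with h | ⟨S₀, h₀⟩
    · rw [h]
      exact finite_empty
    obtain ⟨hFS, hS, P, Q, hP, hQ, hxP, hyP, hyQ, hPS, hQS⟩ := h₀
    have hne : (S₀ \ F).Nonempty := by
      rw [← encard_ne_zero, hS]
      simp
    obtain ⟨v, hvS, hvF⟩ := hne
    have hcP := induce_insert_connected hP (hPS.symm ▸ hvS)
    have hcQ := induce_insert_connected hQ (hQS.symm ▸ hvS)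
    -- Tightness makes `v` adjacent to both `P` and `Q`, so a path can cross `S₀` at `v` alone;
    -- since `v ∉ F ⊆ S₀`, it avoids `F`.
    have hc : (X.induce (insert v P ∪ insert v Q)).Connected :=
      SimpleGraph.induce_union_connected hcP.preconnected hcQ.preconnected
        ⟨v, mem_insert _ _, mem_insert _ _⟩
    obtain ⟨p, hp⟩ := exists_walk_of_induce_connected hc (x := x) (y := y)
      (Or.inl (mem_insert_of_mem _ hxP)) (Or.inr (mem_insert_of_mem _ hyQ))
    have hpF : ∀ z ∈ p.support, z ∉ F := by
      intro z hz hzF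
      rcases hp z hz with (rfl | h) | (rfl | h)
      · exact hvF hzF
      · have := hFS hzF
        rw [← hPS] at this
        exact this.1 h
      · exact hvF hzF
      · have := hFS hzF
        rw [← hQS] at this
        exact this.1 h
    refine (Set.Finite.biUnion (List.finite_toSet p.support)
      (fun z _ => ih (insert z F))).subset ?_
    rintro S ⟨hFS', hS', hT⟩
    obtain ⟨P', Q', hP', hQ', hxP', hyP', hyQ', hPS', hQS'⟩ := id hT
    obtain ⟨z, hz, hzS⟩ := exists_mem_support_boundary p hxP' hyP'
    rw [hPS'] at hzS
    refine mem_biUnion (x := z) hz ⟨insert_subset hzS hFS', ?_, hT⟩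
    have h1 : insert z (S \ insert z F) = S \ F := by
      ext w
      simp only [mem_insert_iff, Set.mem_sdiff, not_or]
      constructor
      · rintro (rfl | h)
        · exact ⟨hzS, hpF _ hz⟩
        · exact ⟨h.1, h.2.2⟩
      · rintro ⟨h, h'⟩
        by_cases hw : w = z
        · exact Or.inl hw
        · exact Or.inr ⟨h, hw, h'⟩
    have h2 : z ∉ S \ insert z F := fun h => h.2 (mem_insert _ _)
    have h3 := encard_insert_of_notMem h2
    rw [h1, hS', Nat.cast_add, Nat.cast_one] at h3
    exact (ENat.add_left_injective_of_ne_top ENat.one_ne_top h3).symm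

theorem finite_isTightSeparator (X : SimpleGraph V) (x y : V) (n : ℕ) :
    {S : Set V | S.encard = n ∧ IsTightSeparator X x y S}.Finite := by
  refine (finite_isTightSeparator_of_subset X x y n ∅).subset ?_
  rintro S ⟨h, h'⟩
  exact ⟨empty_subset S, by simpa using h, h'⟩

/-- A connected set is determined by its boundary and one of its vertices. -/
theorem eq_of_boundary_eq {x : V} (hC : (X.induce C).Connected) (hD : (X.induce D).Connected)
    (h : boundary X C = boundary X D) (hx : x ∈ C) (hx' : x ∈ D) : C = D := by
  apply Subset.antisymm
  · exact subset_of_disjoint_boundary hC hx hx' (h ▸ Set.disjoint_right.2 fun _ h => h.1)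
  · exact subset_of_disjoint_boundary hD hx' hx (h ▸ Set.disjoint_right.2 fun _ h => h.1)

end TightSeparators

end VertexCuts

/-! ### Profiles and their separators -/

namespace VertexCuts

variable {V : Type u} {X : SimpleGraph V} {A B C D E K S T : Set V}

/-- A family of points, each of which lies consistently on one side of every set of vertices with
at most `κ` boundary vertices, where no two points are separated by fewer than `κ` vertices.
`In A i` means that the point `i` lies in `A`. -/
structure IsProfile (X : SimpleGraph V) (κ : ℕ) {ι : Type v} (In : Set V → ι → Prop) : Prop where
  mono : ∀ {A B : Set V} {i : ι}, A ⊆ B → In A i → In B i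
  star_iff : ∀ {A : Set V} {i : ι}, (boundary X A).encard ≤ κ → (In (starCompl X A) i ↔ ¬ In A i)
  inter : ∀ {A B : Set V} {i : ι}, In A i → In B i → (frame X A B).encard ≤ κ → In (A ∩ B) i
  exists_component : ∀ {A : Set V} {i : ι}, (boundary X A).encard ≤ κ → In A i →
    ∃ K, IsComponent X A K ∧ In K i
  minimal : ∀ {A : Set V} {i j : ι}, In A i → In (starCompl X A) j →
    (κ : ℕ∞) ≤ (boundary X A).encard

/-- A set with `κ` boundary vertices that separates two points. -/
def IsSep (X : SimpleGraph V) (κ : ℕ) {ι : Type v} (In : Set V → ι → Prop) (C : Set V) : Prop :=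
  (boundary X C).encard = κ ∧ (∃ i, In C i) ∧ ∃ i, In (starCompl X C) i

/-- The connected separating sets. -/
def sepCuts (X : SimpleGraph V) (κ : ℕ) {ι : Type v} (In : Set V → ι → Prop) : Set (Set V) :=
  {C | (X.induce C).Connected ∧ IsSep X κ In C}

variable {κ : ℕ} {ι : Type v} {In : Set V → ι → Prop} {i j : ι}

section Separators

theorem IsSep.finite (h : IsSep X κ In C) : (boundary X C).Finite :=
  finite_of_encard_eq_coe h.1

theorem IsSep.ncard (h : IsSep X κ In C) : (boundary X C).ncard = κ := by
  rw [Set.ncard, h.1, ENat.toNat_natCast]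

/-- A proper subset of `NC` has fewer than `κ` vertices, too few to separate two points. -/
theorem IsProfile.boundary_eq (hP : IsProfile X κ In) (hC : IsSep X κ In C)
    (hK : boundary X K ⊆ boundary X C) (hi : In K i) (hj : In (starCompl X K) j) :
    boundary X K = boundary X C :=
  (hC.finite.subset hK).eq_of_subset_of_encard_le hK (hC.1.trans_le (hP.minimal hi hj))

theorem IsProfile.boundary_starCompl (hP : IsProfile X κ In) (hC : IsSep X κ In C) :
    boundary X (starCompl X C) = boundary X C := by
  obtain ⟨-, ⟨i, hi⟩, ⟨j, hj⟩⟩ := id hC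
  exact hP.boundary_eq hC (boundary_starCompl_subset X C) hj (hP.mono (subset_star_star X C) hi)

theorem IsProfile.star_star (hP : IsProfile X κ In) (hC : IsSep X κ In C) :
    starCompl X (starCompl X C) = C := by
  rw [starCompl, hP.boundary_starCompl hC, starCompl_union_boundary, compl_compl]

theorem IsProfile.isSep_starCompl (hP : IsProfile X κ In) (hC : IsSep X κ In C) :
    IsSep X κ In (starCompl X C) := by
  refine ⟨(hP.boundary_starCompl hC).symm ▸ hC.1, hC.2.2, ?_⟩
  rw [hP.star_star hC]
  exact hC.2.1

theorem IsProfile.star_iff' (hP : IsProfile X κ In) (hC : IsSep X κ In C) :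
    In (starCompl X C) i ↔ ¬ In C i :=
  hP.star_iff hC.1.le

theorem IsProfile.nonempty (hP : IsProfile X κ In) (h : In A i) : A.Nonempty := by
  rw [nonempty_iff_ne_empty]
  rintro rfl
  have h1 : boundary X (∅ : Set V) = ∅ := by
    ext v
    simp [boundary]
  have h2 := hP.star_iff (i := i) (A := ∅) (by rw [h1]; simp)
  exact h2.1 (hP.mono (empty_subset _) h) h

end Separators

/-! ### Counting links: separators form a thin cut system -/

section Corners

theorem ncard_frame (hC : (boundary X C).Finite) (hD : (boundary X D).Finite) :
    (frame X C D).ncard = (C ∩ boundary X D).ncard + (D ∩ boundary X C).ncard +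
      (boundary X C ∩ boundary X D).ncard := by
  have f1 : (C ∩ boundary X D).Finite := hD.subset inter_subset_right
  have f2 : (D ∩ boundary X C).Finite := hC.subset inter_subset_right
  have f3 : (boundary X C ∩ boundary X D).Finite := hC.subset inter_subset_left
  rw [frame, ncard_union_eq _ (f1.union f2) f3, ncard_union_eq _ f1 f2]
  · exact Set.disjoint_left.2 fun v h h' => h.2.1 h'.1
  · refine Set.disjoint_left.2 ?_
    rintro v (h | h) h'
    · exact h'.1.1 h.1
    · exact h'.2.1 h.1

theorem ncard_links (C : Set V) (hD : (boundary X D).Finite) :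
    (C ∩ boundary X D).ncard + (starCompl X C ∩ boundary X D).ncard +
      (boundary X C ∩ boundary X D).ncard = (boundary X D).ncard := by
  have f (S : Set V) : (S ∩ boundary X D).Finite := hD.subset inter_subset_right
  rw [← ncard_union_eq _ (f _) (f _), ← ncard_union_eq _ ((f _).union (f _)) (f _)]
  · congr 1
    ext v
    simp only [mem_union, mem_inter_iff, mem_starCompl]
    tauto
  · refine Set.disjoint_left.2 ?_
    rintro v (h | h) h'
    · exact h'.1.1 h.1
    · exact (mem_starCompl.1 h.1).2 h'.1
  · exact Set.disjoint_left.2 fun v h h' => (mem_starCompl.1 h'.1).1 h.1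

theorem finite_frame (hC : (boundary X C).Finite) (hD : (boundary X D).Finite) :
    (frame X C D).Finite :=
  (hC.union hD).subset <| by
    rintro v ((h | h) | h)
    · exact Or.inr h.2
    · exact Or.inl h.2
    · exact Or.inl h.1

/-- A corner in which there is a point has at least `κ` vertices in its frame. -/
theorem IsProfile.le_ncard_frame (hP : IsProfile X κ In) (hC : IsSep X κ In C)
    (hD : IsSep X κ In D) (hi : In C i) (hi' : In D i) :
    κ ≤ (frame X C D).ncard := by
  by_contra! hlt
  -- A frame this small puts the point into `C ∩ D`, whose boundary then separates it from a point
  -- of `C^*` with fewer than `κ` vertices.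
  have hle : (frame X C D).encard ≤ κ := by
    rw [← (finite_frame hC.finite hD.finite).cast_ncard_eq]
    exact_mod_cast hlt.le
  obtain ⟨j, hj⟩ := hC.2.2
  have h1 := hP.minimal (hP.inter hi hi' hle) (hP.mono (starCompl_antitone inter_subset_left) hj)
  have h2 := h1.trans (encard_le_encard (boundary_inter_subset_frame X C D))
  rw [← (finite_frame hC.finite hD.finite).cast_ncard_eq] at h2
  have h3 : κ ≤ (frame X C D).ncard := by exact_mod_cast h2
  omega

/-- The sizes of the links of two separators. -/
theorem IsProfile.links (hP : IsProfile X κ In) (hC : IsSep X κ In C) (hD : IsSep X κ In D) :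
    (C ∩ boundary X D).ncard + (starCompl X C ∩ boundary X D).ncard +
      (boundary X C ∩ boundary X D).ncard = κ ∧
    (D ∩ boundary X C).ncard + (starCompl X D ∩ boundary X C).ncard +
      (boundary X C ∩ boundary X D).ncard = κ ∧
    (frame X C D).ncard = (C ∩ boundary X D).ncard + (D ∩ boundary X C).ncard +
      (boundary X C ∩ boundary X D).ncard ∧
    (frame X C (starCompl X D)).ncard = (C ∩ boundary X D).ncard +
      (starCompl X D ∩ boundary X C).ncard + (boundary X C ∩ boundary X D).ncard ∧
    (frame X (starCompl X C) D).ncard = (starCompl X C ∩ boundary X D).ncard +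
      (D ∩ boundary X C).ncard + (boundary X C ∩ boundary X D).ncard ∧
    (frame X (starCompl X C) (starCompl X D)).ncard = (starCompl X C ∩ boundary X D).ncard +
      (starCompl X D ∩ boundary X C).ncard + (boundary X C ∩ boundary X D).ncard := by
  have hC' := hP.isSep_starCompl hC
  have hD' := hP.isSep_starCompl hD
  have eC := hP.boundary_starCompl hC
  have eD := hP.boundary_starCompl hD
  refine ⟨hD.ncard ▸ ncard_links C hD.finite, ?_, ncard_frame hC.finite hD.finite, ?_, ?_, ?_⟩
  · rw [inter_comm (boundary X C)]
    exact hC.ncard ▸ ncard_links D hC.finite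
  · rw [ncard_frame hC.finite hD'.finite, eD]
  · rw [ncard_frame hC'.finite hD.finite, eC]
  · rw [ncard_frame hC'.finite hD'.finite, eC, eD]

/-- The two opposite frames have at least `κ` vertices each, and by the counts in `links` they have
`2κ` in total. Equality must hold in both, and comparing with `|NC| = |ND| = κ` pairs the links. -/
theorem IsProfile.links_eq (hP : IsProfile X κ In) (hC : IsSep X κ In C) (hD : IsSep X κ In D)
    (h1 : In C i) (h2 : In D i) (h3 : In (starCompl X C) j) (h4 : In (starCompl X D) j) :
    (C ∩ boundary X D).ncard = (starCompl X D ∩ boundary X C).ncard ∧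
    (starCompl X C ∩ boundary X D).ncard = (D ∩ boundary X C).ncard ∧
    (frame X C D).ncard = κ := by
  have a := hP.links hC hD
  have b := hP.le_ncard_frame hC hD h1 h2
  have c := hP.le_ncard_frame (hP.isSep_starCompl hC) (hP.isSep_starCompl hD) h3 h4
  omega

/-- If there are points in two opposite corners, then the corners separate them. -/
theorem IsProfile.isSep_inter (hP : IsProfile X κ In) (hC : IsSep X κ In C)
    (hD : IsSep X κ In D) (h1 : In C i) (h2 : In D i) (h3 : In (starCompl X C) j)
    (h4 : In (starCompl X D) j) :
    IsSep X κ In (C ∩ D) ∧ boundary X (C ∩ D) = frame X C D ∧ In (C ∩ D) i := by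
  have hf : (frame X C D).encard = κ := by
    rw [← (finite_frame hC.finite hD.finite).cast_ncard_eq, (hP.links_eq hC hD h1 h2 h3 h4).2.2]
  have hi := hP.inter h1 h2 hf.le
  have hj := hP.mono (starCompl_antitone (inter_subset_left (s := C) (t := D))) h3
  have he : boundary X (C ∩ D) = frame X C D :=
    ((finite_frame hC.finite hD.finite).subset
      (boundary_inter_subset_frame X C D)).eq_of_subset_of_encard_le
      (boundary_inter_subset_frame X C D) (hf.trans_le (hP.minimal hi hj))
  exact ⟨⟨he ▸ hf, ⟨i, hi⟩, ⟨j, hj⟩⟩, he, hi⟩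

/-- If `D` splits the two points split by `C`, these points do. Otherwise both lie on one side of
`D`; a point on the other side and one of the two then occupy opposite corners. -/
theorem IsProfile.exists_opposite (hP : IsProfile X κ In) (hC : IsSep X κ In C)
    (hD : IsSep X κ In D) : ∃ i j,
      (In C i ∧ In D i ∧ In (starCompl X C) j ∧ In (starCompl X D) j) ∨
      (In C i ∧ In (starCompl X D) i ∧ In (starCompl X C) j ∧ In D j) := by
  obtain ⟨-, ⟨a, ha⟩, ⟨b, hb⟩⟩ := id hC
  obtain ⟨-, ⟨c, hc⟩, ⟨d, hd⟩⟩ := id hD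
  have sa := hP.star_iff' (i := a) hD
  have sb := hP.star_iff' (i := b) hD
  have sc := hP.star_iff' (i := c) hC
  have sd := hP.star_iff' (i := d) hC
  by_cases h1 : In D a <;> by_cases h2 : In D b
  · by_cases h3 : In C d
    · exact ⟨d, b, by tauto⟩
    · exact ⟨a, d, by tauto⟩
  · exact ⟨a, b, by tauto⟩
  · exact ⟨a, b, by tauto⟩
  · by_cases h3 : In C c
    · exact ⟨c, b, by tauto⟩
    · exact ⟨a, c, by tauto⟩

/-- A component of a separator that contains one of the points is a cut. -/
theorem IsProfile.component_mem (hP : IsProfile X κ In) (hC : IsSep X κ In C)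
    (hK : IsComponent X C K) (hi : In K i) :
    K ∈ sepCuts X κ In ∧ boundary X K = boundary X C := by
  obtain ⟨j, hj⟩ := hC.2.2
  have hj' := hP.mono (starCompl_antitone hK.subset) hj
  have he := hP.boundary_eq hC hK.boundary_subset hi hj'
  exact ⟨⟨hK.connected, he ▸ hC.1, ⟨i, hi⟩, ⟨j, hj'⟩⟩, he⟩

theorem IsProfile.exists_component_mem (hP : IsProfile X κ In) (hC : IsSep X κ In C)
    (hi : In C i) : ∃ K ∈ sepCuts X κ In, IsComponent X C K ∧ boundary X K = boundary X C ∧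
      In K i := by
  obtain ⟨K, hK, hKi⟩ := hP.exists_component hC.1.le hi
  obtain ⟨h1, h2⟩ := hP.component_mem hC hK hKi
  exact ⟨K, h1, hK, h2, hKi⟩

theorem IsProfile.exists_of_containsCut (hP : IsProfile X κ In)
    (h : ContainsCut (sepCuts X κ In) A) : ∃ i, In A i := by
  obtain ⟨E, hE, hEA⟩ := h
  obtain ⟨i, hi⟩ := hE.2.2.1
  exact ⟨i, hP.mono hEA hi⟩

theorem OppositeCorners.cases (h : OppositeCorners X C D A B) (hC : starCompl X (starCompl X C) = C)
    (hD : starCompl X (starCompl X D) = D) :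
    ∃ S T, (S = C ∨ S = starCompl X C) ∧ (T = D ∨ T = starCompl X D) ∧ A = S ∩ T ∧
      B = starCompl X S ∩ starCompl X T := by
  rcases h with ⟨rfl, rfl⟩ | ⟨rfl, rfl⟩ | ⟨rfl, rfl⟩ | ⟨rfl, rfl⟩
  · exact ⟨C, D, Or.inl rfl, Or.inl rfl, rfl, rfl⟩
  · exact ⟨starCompl X C, starCompl X D, Or.inr rfl, Or.inr rfl, rfl, by rw [hC, hD]⟩
  · exact ⟨C, starCompl X D, Or.inl rfl, Or.inr rfl, rfl, by rw [hD]⟩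
  · exact ⟨starCompl X C, D, Or.inr rfl, Or.inl rfl, rfl, by rw [hC]⟩

theorem IsProfile.isSep_of_eq (hP : IsProfile X κ In) (hC : IsSep X κ In C)
    (h : S = C ∨ S = starCompl X C) : IsSep X κ In S := by
  rcases h with rfl | rfl
  · exact hC
  · exact hP.isSep_starCompl hC

theorem IsProfile.isThinCutSystem (hP : IsProfile X κ In) :
    IsThinCutSystem X (sepCuts X κ In) := by
  refine ⟨⟨fun C hC => hC.1, fun C hC => hC.2.finite, fun C hC => hP.star_star hC.2, ?_, ?_⟩,
    κ, fun C hC => hC.2.1⟩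
  · intro C hC D hD A B hO hA hB K hK hKc
    obtain ⟨S, T, hS, hT, rfl, rfl⟩ := hO.cases (hP.star_star hC.2) (hP.star_star hD.2)
    have hS' := hP.isSep_of_eq hC.2 hS
    have hT' := hP.isSep_of_eq hD.2 hT
    obtain ⟨k, hk⟩ := hP.exists_of_containsCut hKc
    obtain ⟨j, hj⟩ := hP.exists_of_containsCut hB
    have hk' := hP.mono hK.subset hk
    have h := hP.isSep_inter hS' hT' (hP.mono inter_subset_left hk')
      (hP.mono inter_subset_right hk') (hP.mono inter_subset_left hj)
      (hP.mono inter_subset_right hj)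
    exact (hP.component_mem h.1 hK hk).1
  · have key : ∀ S T : Set V, IsSep X κ In S → IsSep X κ In T → ∀ i j, In S i → In T i →
        In (starCompl X S) j → In (starCompl X T) j → ContainsCut (sepCuts X κ In) (S ∩ T) := by
      intro S T hS hT i j h1 h2 h3 h4
      obtain ⟨h, -, hi⟩ := hP.isSep_inter hS hT h1 h2 h3 h4
      obtain ⟨K, hK, hK', -⟩ := hP.exists_component_mem h hi
      exact ⟨K, hK, hK'.subset⟩
    intro C hC D hD
    have sC := hP.star_star hC.2
    have sD := hP.star_star hD.2
    have hC' := hP.isSep_starCompl hC.2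
    have hD' := hP.isSep_starCompl hD.2
    obtain ⟨i, j, ⟨h1, h2, h3, h4⟩ | ⟨h1, h2, h3, h4⟩⟩ := hP.exists_opposite hC.2 hD.2
    · exact ⟨_, _, Or.inl ⟨rfl, rfl⟩, key _ _ hC.2 hD.2 i j h1 h2 h3 h4,
        key _ _ hC' hD' j i h3 h4 (sC.symm ▸ h1) (sD.symm ▸ h2)⟩
    · exact ⟨_, _, Or.inr (Or.inr (Or.inl ⟨rfl, rfl⟩)),
        key _ _ hC.2 hD' i j h1 h2 h3 (sD.symm ▸ h4),
        key _ _ hC' hD.2 j i h3 h4 (sC.symm ▸ h1) h2⟩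

end Corners

/-! ### Crossing separators and nestedness -/

section Crossing

/-- `C` and `D` cross: each of their four links is non-empty. -/
def Crosses (X : SimpleGraph V) (C D : Set V) : Prop :=
  (C ∩ boundary X D).Nonempty ∧ (starCompl X C ∩ boundary X D).Nonempty ∧
    (D ∩ boundary X C).Nonempty ∧ (starCompl X D ∩ boundary X C).Nonempty

theorem Crosses.symm (h : Crosses X C D) : Crosses X D C :=
  ⟨h.2.2.1, h.2.2.2, h.1, h.2.1⟩

/-- Two separators that do not cross have a corner whose two adjacent links are empty. -/
theorem IsProfile.exists_empty_links (hP : IsProfile X κ In) (hC : IsSep X κ In C)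
    (hD : IsSep X κ In D) (h : ¬ Crosses X C D) :
    ∃ S T, (S = C ∨ S = starCompl X C) ∧ (T = D ∨ T = starCompl X D) ∧
      S ∩ boundary X D = ∅ ∧ T ∩ boundary X C = ∅ := by
  have e (S T : Set V) (hT : IsSep X κ In T) : (S ∩ boundary X T).Nonempty ↔
      (S ∩ boundary X T).ncard ≠ 0 := by
    rw [← pos_iff_ne_zero, Set.ncard_pos (hT.finite.subset inter_subset_right)]
  have e' (S T : Set V) (hT : IsSep X κ In T) : S ∩ boundary X T = ∅ ↔
      (S ∩ boundary X T).ncard = 0 := by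
    rw [Set.ncard_eq_zero (hT.finite.subset inter_subset_right)]
  have hC' := hP.isSep_starCompl hC
  have hD' := hP.isSep_starCompl hD
  simp only [Crosses, e _ _ hC, e _ _ hD] at h
  obtain ⟨i, j, ⟨h1, h2, h3, h4⟩ | ⟨h1, h2, h3, h4⟩⟩ := hP.exists_opposite hC hD
  · obtain ⟨a, b, -⟩ := hP.links_eq hC hD h1 h2 h3 h4
    by_cases h0 : (C ∩ boundary X D).ncard = 0
    · exact ⟨C, starCompl X D, Or.inl rfl, Or.inr rfl, (e' _ _ hD).2 h0,
        (e' _ _ hC).2 (by omega)⟩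
    · exact ⟨starCompl X C, D, Or.inr rfl, Or.inl rfl, (e' _ _ hD).2 (by omega),
        (e' _ _ hC).2 (by omega)⟩
  · obtain ⟨a, b, -⟩ := hP.links_eq hC hD' h1 h2 h3 ((hP.star_star hD).symm ▸ h4)
    rw [hP.boundary_starCompl hD, hP.star_star hD] at a
    rw [hP.boundary_starCompl hD] at b
    by_cases h0 : (C ∩ boundary X D).ncard = 0
    · exact ⟨C, D, Or.inl rfl, Or.inl rfl, (e' _ _ hD).2 h0, (e' _ _ hC).2 (by omega)⟩
    · exact ⟨starCompl X C, starCompl X D, Or.inr rfl, Or.inr rfl, (e' _ _ hD).2 (by omega),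
        (e' _ _ hC).2 (by omega)⟩

/-- Whether separators cross can be read off from one of the boundaries. -/
theorem IsProfile.crosses_iff (hP : IsProfile X κ In) (hC : IsSep X κ In C)
    (hD : IsSep X κ In D) : Crosses X C D ↔
      (D ∩ boundary X C).Nonempty ∧ (starCompl X D ∩ boundary X C).Nonempty := by
  refine ⟨fun h => h.2.2, fun h => ?_⟩
  by_contra hn
  obtain ⟨S, T, -, hT, -, hT'⟩ := hP.exists_empty_links hC hD hn
  rcases hT with rfl | rfl
  · exact h.1.ne_empty hT'
  · exact h.2.ne_empty hT'

theorem IsProfile.crosses_congr (hP : IsProfile X κ In) (hC : IsSep X κ In C)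
    (hK : IsSep X κ In K) (hD : IsSep X κ In D) (h : boundary X K = boundary X C) :
    Crosses X K D ↔ Crosses X C D := by
  rw [hP.crosses_iff hC hD, hP.crosses_iff hK hD, h]

theorem IsProfile.crosses_starCompl_left (hP : IsProfile X κ In) (hC : IsSep X κ In C)
    (hD : IsSep X κ In D) : Crosses X (starCompl X C) D ↔ Crosses X C D :=
  hP.crosses_congr hC (hP.isSep_starCompl hC) hD (hP.boundary_starCompl hC)

theorem IsProfile.crosses_starCompl_right (hP : IsProfile X κ In) (hC : IsSep X κ In C)
    (hD : IsSep X κ In D) : Crosses X C (starCompl X D) ↔ Crosses X C D :=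
  ⟨fun h => ((hP.crosses_starCompl_left hD hC).1 h.symm).symm,
    fun h => ((hP.crosses_starCompl_left hD hC).2 h.symm).symm⟩

/-- If there is a point in a corner with empty links, then the boundaries agree. -/
theorem IsProfile.boundary_eq_of_links_empty (hP : IsProfile X κ In) (hC : IsSep X κ In C)
    (hD : IsSep X κ In D) (h1 : In C i) (h2 : In D i) (h3 : C ∩ boundary X D = ∅)
    (h4 : D ∩ boundary X C = ∅) : boundary X C = boundary X D := by
  have h := hP.le_ncard_frame hC hD h1 h2
  rw [frame, h3, h4, empty_union, empty_union] at h
  have e1 : boundary X C ∩ boundary X D = boundary X C :=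
    eq_of_subset_of_ncard_le inter_subset_left (hC.ncard.trans_le h) hC.finite
  have e2 : boundary X C ∩ boundary X D = boundary X D :=
    eq_of_subset_of_ncard_le inter_subset_right (hD.ncard.trans_le h) hD.finite
  exact e1.symm.trans e2

/-- The only gap between non-crossing and nested is a corner with empty links that contains a cut.
In that case `NC = ND`, so the connected sets `C` and `D` are equal or disjoint, and an empty corner
serves instead. -/
theorem IsProfile.nested_iff (hP : IsProfile X κ In) (hC : C ∈ sepCuts X κ In)
    (hD : D ∈ sepCuts X κ In) : Nested X (sepCuts X κ In) C D ↔ ¬ Crosses X C D := by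
  constructor
  · rintro (h | h | h | h) ⟨h1, h2, h3, h4⟩
    · exact h1.ne_empty h.2.1
    · exact h1.ne_empty h.2.1
    · exact h2.ne_empty h.2.1
    · exact h2.ne_empty h.2.1
  · intro h
    obtain ⟨S, T, hS, hT, h1, h2⟩ := hP.exists_empty_links hC.2 hD.2 h
    by_cases hc : ContainsCut (sepCuts X κ In) (S ∩ T)
    · obtain ⟨i, hi⟩ := hP.exists_of_containsCut hc
      have bS : boundary X S = boundary X C := by
        rcases hS with rfl | rfl
        · rfl
        · exact hP.boundary_starCompl hC.2
      have bT : boundary X T = boundary X D := by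
        rcases hT with rfl | rfl
        · rfl
        · exact hP.boundary_starCompl hD.2
      have hb := hP.boundary_eq_of_links_empty (hP.isSep_of_eq hC.2 hS) (hP.isSep_of_eq hD.2 hT)
        (hP.mono inter_subset_left hi) (hP.mono inter_subset_right hi) (bT ▸ h1) (bS ▸ h2)
      rw [bS, bT] at hb
      have hCD : C ∩ boundary X D = ∅ := by
        rw [← hb, ← disjoint_iff_inter_eq_empty, Set.disjoint_right]
        exact fun v hv => hv.1
      have hDC : D ∩ boundary X C = ∅ := by
        rw [hb, ← disjoint_iff_inter_eq_empty, Set.disjoint_right]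
        exact fun v hv => hv.1
      by_cases hx : (C ∩ D).Nonempty
      · right; left
        obtain ⟨x, hxC, hxD⟩ := hx
        have hsub : C ⊆ D := subset_of_disjoint_boundary hC.1 hxC hxD
          (disjoint_iff_inter_eq_empty.2 hCD)
        refine ⟨?_, (hP.boundary_starCompl hD.2).symm ▸ hCD, ?_⟩
        · rintro ⟨E, hE, hE'⟩
          obtain ⟨y, hy⟩ := nonempty_of_induce_connected hE.1
          exact (mem_starCompl.1 (hE' hy).2).1 (hsub (hE' hy).1)
        · rw [hb, ← disjoint_iff_inter_eq_empty, Set.disjoint_left]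
          exact fun v hv => (mem_starCompl.1 hv).2
      · left
        refine ⟨?_, hCD, hDC⟩
        rintro ⟨E, hE, hE'⟩
        obtain ⟨y, hy⟩ := nonempty_of_induce_connected hE.1
        exact hx ⟨y, hE' hy⟩
    · have bC := hP.boundary_starCompl hC.2
      have bD := hP.boundary_starCompl hD.2
      rcases hS with rfl | rfl <;> rcases hT with rfl | rfl
      · exact Or.inl ⟨hc, h1, h2⟩
      · exact Or.inr (Or.inl ⟨hc, bD.symm ▸ h1, h2⟩)
      · exact Or.inr (Or.inr (Or.inl ⟨hc, h1, bC.symm ▸ h2⟩))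
      · exact Or.inr (Or.inr (Or.inr ⟨hc, bD.symm ▸ h1, bC.symm ▸ h2⟩))

end Crossing

end VertexCuts

namespace VertexCuts

variable {V : Type u} {X : SimpleGraph V} {A B C D E K P Q R S T : Set V}
variable {κ : ℕ} {ι : Type v} {In : Set V → ι → Prop} {i j k l : ι}

/-! ### Finiteness and submodularity of the number of crossing cuts -/

section Count

/-- The cuts that cross `C`. -/
def crossSet (X : SimpleGraph V) (κ : ℕ) {ι : Type v} (In : Set V → ι → Prop) (C : Set V) :
    Set (Set V) :=
  {E ∈ sepCuts X κ In | Crosses X C E}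

/-- If `D` crosses `C`, then `ND` is a tight separator of two vertices of the finite set `NC`, and
`D` is determined by `ND` and one of its own vertices. -/
theorem IsProfile.finite_crossSet (hP : IsProfile X κ In) (hC : IsSep X κ In C) :
    (crossSet X κ In C).Finite := by
  have hfin : (⋃ x ∈ boundary X C, ⋃ y ∈ boundary X C,
      ⋃ S ∈ {S : Set V | S.encard = κ ∧ IsTightSeparator X x y S},
        {D | (X.induce D).Connected ∧ x ∈ D ∧ boundary X D = S}).Finite := by
    refine hC.finite.biUnion fun x _ => hC.finite.biUnion fun y _ =>
      (finite_isTightSeparator X x y κ).biUnion fun S _ => Set.Subsingleton.finite ?_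
    rintro D ⟨h1, h2, h3⟩ D' ⟨h1', h2', h3'⟩
    exact eq_of_boundary_eq h1 h1' (h3.trans h3'.symm) h2 h2'
  refine hfin.subset ?_
  rintro D ⟨hD, hX⟩
  obtain ⟨x, hxD, hxC⟩ := hX.2.2.1
  obtain ⟨j, hj⟩ := hD.2.2.2
  have hD' := hP.isSep_starCompl hD.2
  -- The second connected set with boundary `ND`. It crosses `C` because its boundary is that of
  -- `D`, which provides `y`.
  obtain ⟨K, hK, hKc, hb, -⟩ := hP.exists_component_mem hD' hj
  have hbD := hb.trans (hP.boundary_starCompl hD.2)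
  have hXK : Crosses X K C := (hP.crosses_congr hD.2 hK.2 hC hbD).2 hX.symm
  obtain ⟨y, hyK, hyC⟩ := hXK.1
  simp only [mem_iUnion, exists_prop]
  exact ⟨x, hxC, y, hyC, boundary X D, ⟨hD.2.1, D, K, hD.1, hK.1, hxD,
    (mem_starCompl.1 (hKc.subset hyK)).1, hyK, rfl, hbD⟩, hD.1, hxD, rfl⟩

theorem IsProfile.mu_eq (hP : IsProfile X κ In) (hC : C ∈ sepCuts X κ In) :
    mu X (sepCuts X κ In) C = ((crossSet X κ In C).ncard : ℕ∞) := by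
  rw [(hP.finite_crossSet hC.2).cast_ncard_eq, mu]
  congr 1
  ext D
  constructor
  · rintro ⟨hD, hn⟩
    exact ⟨hD, by rwa [hP.nested_iff hC hD, not_not] at hn⟩
  · rintro ⟨hD, hn⟩
    exact ⟨hD, by rwa [hP.nested_iff hC hD, not_not]⟩

theorem IsProfile.crossSet_congr (hP : IsProfile X κ In) (hC : IsSep X κ In C)
    (hK : IsSep X κ In K) (h : boundary X K = boundary X C) :
    crossSet X κ In K = crossSet X κ In C := by
  ext E
  exact and_congr_right fun hE => hP.crosses_congr hC hK hE.2 h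

theorem IsProfile.crossSet_starCompl (hP : IsProfile X κ In) (hC : IsSep X κ In C) :
    crossSet X κ In (starCompl X C) = crossSet X κ In C :=
  hP.crossSet_congr hC (hP.isSep_starCompl hC) (hP.boundary_starCompl hC)

theorem not_crosses_of_subset (h : K ⊆ D) : ¬ Crosses X K D := by
  rintro ⟨-, -, -, v, hv, hvK⟩
  exact hv (union_boundary_mono h (Or.inr hvK))

theorem IsProfile.not_crosses_of_subset_starCompl (hP : IsProfile X κ In) (hK : IsSep X κ In K)
    (hD : IsSep X κ In D) (h : K ⊆ starCompl X D) : ¬ Crosses X K D := by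
  rw [← hP.crosses_starCompl_right hK hD]
  exact not_crosses_of_subset h

/-- A point in the corner `C^* ∩ T` would force `NC = NE`, but `C` meets `NE` and never `NC`. -/
theorem IsProfile.not_in_of_links_empty (hP : IsProfile X κ In) (hC : IsSep X κ In C)
    (hE : IsSep X κ In E) (hT : T = E ∨ T = starCompl X E) (h1 : starCompl X C ∩ boundary X E = ∅)
    (h2 : T ∩ boundary X C = ∅) (h3 : (C ∩ boundary X E).Nonempty) (hj : In (starCompl X C) j) :
    ¬ In T j := by
  intro hjT
  have bT : boundary X T = boundary X E := by
    rcases hT with rfl | rfl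
    · rfl
    · exact hP.boundary_starCompl hE
  have bC := hP.boundary_starCompl hC
  have h := hP.boundary_eq_of_links_empty (hP.isSep_starCompl hC) (hP.isSep_of_eq hE hT) hj hjT
    (bT.symm ▸ h1) (bC.symm ▸ h2)
  obtain ⟨v, hv, hvE⟩ := h3
  rw [← bT, ← h, bC] at hvE
  exact hvE.1 hv

/-- If `E` crosses neither `C` nor `D`, it has corners with empty links at `C^*` and at `D^*`,
because `K ∩ NE` rules out `C` and `D`. The point `j` lies in `C^*` and `D^*` but on neither of the
two sides of `E` used there, so these sides coincide. That side of `E` misses `NC` and `ND`, hence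
the frame `NK`, so `E` does not cross `K`. -/
theorem IsProfile.crosses_or (hP : IsProfile X κ In) (hC : IsSep X κ In C)
    (hD : IsSep X κ In D) (hE : IsSep X κ In E) (h3 : In (starCompl X C) j)
    (h4 : In (starCompl X D) j) (hK : K ⊆ C ∩ D) (hb : boundary X K = frame X C D)
    (h : Crosses X K E) : Crosses X C E ∨ Crosses X D E := by
  by_contra! hn
  have nC : (C ∩ boundary X E).Nonempty := h.1.mono fun v hv => ⟨(hK hv.1).1, hv.2⟩
  have nD : (D ∩ boundary X E).Nonempty := h.1.mono fun v hv => ⟨(hK hv.1).2, hv.2⟩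
  obtain ⟨S, T, hS, hT, e1, e2⟩ := hP.exists_empty_links hC hE hn.1
  obtain ⟨S', T', hS', hT', e1', e2'⟩ := hP.exists_empty_links hD hE hn.2
  rcases hS with rfl | rfl
  · exact nC.ne_empty e1
  rcases hS' with rfl | rfl
  · exact nD.ne_empty e1'
  have m1 := hP.not_in_of_links_empty hC hE hT e1 e2 nC h3
  have m2 := hP.not_in_of_links_empty hD hE hT' e1' e2' nD h4
  have same : ∀ U : Set V, U ∩ boundary X C = ∅ → U ∩ boundary X D = ∅ →
      ¬ (U ∩ boundary X K).Nonempty := by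
    rintro U u1 u2 ⟨v, hvU, hv⟩
    rw [hb] at hv
    rcases hv with (hv | hv) | hv
    · exact (u2 ▸ (⟨hvU, hv.2⟩ : v ∈ U ∩ boundary X D) : v ∈ (∅ : Set V))
    · exact (u1 ▸ (⟨hvU, hv.2⟩ : v ∈ U ∩ boundary X C) : v ∈ (∅ : Set V))
    · exact (u1 ▸ (⟨hvU, hv.1⟩ : v ∈ U ∩ boundary X C) : v ∈ (∅ : Set V))
  have hj := hP.star_iff' (i := j) hE
  rcases hT with rfl | rfl <;> rcases hT' with rfl | rfl
  · exact same _ e2 e2' h.2.2.1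
  · tauto
  · tauto
  · exact same _ e2 e2' h.2.2.2

/-- Submodularity of the number of crossing cuts. -/
theorem IsProfile.crossSet_submodular (hP : IsProfile X κ In) (hC : IsSep X κ In C)
    (hD : IsSep X κ In D) (hX : Crosses X C D)
    (hD' : D ∈ sepCuts X κ In ∨ starCompl X D ∈ sepCuts X κ In)
    (h1 : In C i) (h2 : In D i) (h3 : In (starCompl X C) j) (h4 : In (starCompl X D) j) :
    ∃ A ∈ sepCuts X κ In, ∃ B ∈ sepCuts X κ In,
      (crossSet X κ In A).ncard + (crossSet X κ In B).ncard <
        (crossSet X κ In C).ncard + (crossSet X κ In D).ncard ∧ In A i ∧ In B j ∧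
      (∀ x, In (starCompl X C) x ∨ In (starCompl X D) x → In (starCompl X A) x) ∧
      (∀ x, In C x ∨ In D x → In (starCompl X B) x) := by
  have hC' := hP.isSep_starCompl hC
  have hD'' := hP.isSep_starCompl hD
  have sC := hP.star_star hC
  have sD := hP.star_star hD
  obtain ⟨hA, bA, hi⟩ := hP.isSep_inter hC hD h1 h2 h3 h4
  obtain ⟨hB, bB, hj⟩ := hP.isSep_inter hC' hD'' h3 h4 (sC.symm ▸ h1) (sD.symm ▸ h2)
  obtain ⟨K, hK, hKc, bK, hKi⟩ := hP.exists_component_mem hA hi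
  obtain ⟨L, hL, hLc, bL, hLj⟩ := hP.exists_component_mem hB hj
  have KC : K ⊆ C := hKc.subset.trans inter_subset_left
  have KD : K ⊆ D := hKc.subset.trans inter_subset_right
  have LC : L ⊆ starCompl X C := hLc.subset.trans inter_subset_left
  have LD : L ⊆ starCompl X D := hLc.subset.trans inter_subset_right
  refine ⟨K, hK, L, hL, ?_, hKi, hLj, ?_, ?_⟩
  · have fC := hP.finite_crossSet hC
    have fD := hP.finite_crossSet hD
    have e1 := ncard_union_add_ncard_inter _ _ (hP.finite_crossSet hK.2) (hP.finite_crossSet hL.2)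
    have e2 := ncard_union_add_ncard_inter _ _ fC fD
    -- A cut crossing both has boundary vertices in `K` and in `L`, hence on both sides of `C` and
    -- of `D`; by `crosses_iff` that suffices.
    have hinter : crossSet X κ In K ∩ crossSet X κ In L ⊆
        crossSet X κ In C ∩ crossSet X κ In D := by
      rintro E ⟨⟨hE, hEK⟩, -, hEL⟩
      constructor
      · exact ⟨hE, ((hP.crosses_iff hE.2 hC).2 ⟨hEK.1.mono fun v hv => ⟨KC hv.1, hv.2⟩,
          hEL.1.mono fun v hv => ⟨LC hv.1, hv.2⟩⟩).symm⟩
      · exact ⟨hE, ((hP.crosses_iff hE.2 hD).2 ⟨hEK.1.mono fun v hv => ⟨KD hv.1, hv.2⟩,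
          hEL.1.mono fun v hv => ⟨LD hv.1, hv.2⟩⟩).symm⟩
    have hunion : crossSet X κ In K ∪ crossSet X κ In L ⊂
        crossSet X κ In C ∪ crossSet X κ In D := by
      rw [ssubset_iff_subset_not_subset]
      constructor
      · rintro E (⟨hE, hEK⟩ | ⟨hE, hEL⟩)
        · exact (hP.crosses_or hC hD hE.2 h3 h4 hKc.subset (bK.trans bA) hEK).imp
            (fun h => ⟨hE, h⟩) (fun h => ⟨hE, h⟩)
        · have := hP.crosses_or hC' hD'' hE.2 (sC.symm ▸ h1) (sD.symm ▸ h2) hLc.subset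
            (bL.trans bB) hEL
          rw [hP.crosses_starCompl_left hC hE.2, hP.crosses_starCompl_left hD hE.2] at this
          exact this.imp (fun h => ⟨hE, h⟩) (fun h => ⟨hE, h⟩)
      -- Strictness: whichever of `D`, `D^*` is a cut crosses `C`, but crosses neither `K` nor `L`,
      -- each of which lies on one side of `D`.
      · intro hsub
        have nK : ¬ Crosses X K D := not_crosses_of_subset KD
        have nL : ¬ Crosses X L D := hP.not_crosses_of_subset_starCompl hL.2 hD LD
        rcases hD' with h | h
        · rcases hsub (Or.inl ⟨h, hX⟩) with h' | h'
          · exact nK h'.2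
          · exact nL h'.2
        · rcases hsub (Or.inl ⟨h, (hP.crosses_starCompl_right hC hD).2 hX⟩) with h' | h'
          · exact nK ((hP.crosses_starCompl_right hK.2 hD).1 h'.2)
          · exact nL ((hP.crosses_starCompl_right hL.2 hD).1 h'.2)
    have l1 := ncard_le_ncard hinter (fC.inter_of_left _)
    have l2 := ncard_lt_ncard hunion (fC.union fD)
    omega
  · rintro x (h | h)
    · exact hP.mono (starCompl_antitone KC) h
    · exact hP.mono (starCompl_antitone KD) h
  · rintro x (h | h)
    · exact hP.mono (starCompl_antitone LC) (sC.symm ▸ h)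
    · exact hP.mono (starCompl_antitone LD) (sD.symm ▸ h)

end Count

/-! ### Optimally nested cuts form a nested cut system -/

section Optimal

/-- The set `C` separates the points `i` and `j`. -/
def SeparatesPoints (X : SimpleGraph V) {ι : Type v} (In : Set V → ι → Prop) (C : Set V)
    (i j : ι) : Prop :=
  (In C i ∧ In (starCompl X C) j) ∨ (In C j ∧ In (starCompl X C) i)

/-- The cuts that are optimally nested with respect to a pair of points. -/
def optimalCuts (X : SimpleGraph V) (κ : ℕ) {ι : Type v} (In : Set V → ι → Prop) : Set (Set V) :=
  {C | C ∈ sepCuts X κ In ∧ ∃ i j, SeparatesPoints X In C i j ∧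
    ∀ D ∈ sepCuts X κ In, SeparatesPoints X In D i j →
      mu X (sepCuts X κ In) C ≤ mu X (sepCuts X κ In) D}

theorem SeparatesPoints.symm (h : SeparatesPoints X In C i j) : SeparatesPoints X In C j i :=
  Or.symm h

theorem IsProfile.exists_optimal (hP : IsProfile X κ In) (hC : C ∈ optimalCuts X κ In) :
    ∃ i j, In C i ∧ In (starCompl X C) j ∧ ∀ D ∈ sepCuts X κ In, SeparatesPoints X In D i j →
      (crossSet X κ In C).ncard ≤ (crossSet X κ In D).ncard := by
  obtain ⟨hC, i, j, hij, hopt⟩ := hC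
  have hopt' : ∀ D ∈ sepCuts X κ In, SeparatesPoints X In D i j →
      (crossSet X κ In C).ncard ≤ (crossSet X κ In D).ncard := by
    intro D hD hs
    have := hopt D hD hs
    rw [hP.mu_eq hC, hP.mu_eq hD] at this
    exact_mod_cast this
  rcases hij with h | h
  · exact ⟨i, j, h.1, h.2, hopt'⟩
  · exact ⟨j, i, h.1, h.2, fun D hD hs => hopt' D hD hs.symm⟩

/-- Here `i ∈ C`, `j ∈ C^*`, `k ∈ D`, `l ∈ D^*`. Uncrossing at suitable opposite corners gives two
cuts, each separating one of the pairs, whose `μ`-sum is too small. -/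
theorem IsProfile.not_crosses_of_optimal (hP : IsProfile X κ In) (hC : C ∈ optimalCuts X κ In)
    (hD : D ∈ optimalCuts X κ In) : ¬ Crosses X C D := by
  intro hX
  obtain ⟨i, j, hi, hj, oC⟩ := hP.exists_optimal hC
  obtain ⟨k, l, hk, hl, oD⟩ := hP.exists_optimal hD
  replace hC := hC.1
  replace hD := hD.1
  have sD := hP.star_star hD.2
  have hD' := hP.isSep_starCompl hD.2
  have hX' := (hP.crosses_starCompl_right hC.2 hD.2).2 hX
  have H1 := fun p q => hP.crossSet_submodular (i := p) (j := q) hC.2 hD.2 hX (Or.inl hD)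
  have H2 := fun p q => hP.crossSet_submodular (i := p) (j := q) hC.2 hD' hX'
    (Or.inr (sD.symm ▸ hD))
  rw [sD, hP.crossSet_starCompl hD.2] at H2
  have dC (x : ι) := hP.star_iff' (i := x) hC.2
  have dD (x : ι) := hP.star_iff' (i := x) hD.2
  have dCk := dC k
  have dCl := dC l
  have dDi := dD i
  have dDj := dD j
  have fin : ∀ A ∈ sepCuts X κ In, ∀ B ∈ sepCuts X κ In,
      (crossSet X κ In A).ncard + (crossSet X κ In B).ncard <
        (crossSet X κ In C).ncard + (crossSet X κ In D).ncard →
      ¬ (SeparatesPoints X In A i j ∧ SeparatesPoints X In B k l) ∧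
      ¬ (SeparatesPoints X In A k l ∧ SeparatesPoints X In B i j) := by
    intro A hA B hB hlt
    constructor
    · rintro ⟨h, h'⟩
      have := oC A hA h
      have := oD B hB h'
      omega
    · rintro ⟨h, h'⟩
      have := oD A hA h
      have := oC B hB h'
      omega
  have finC : ∀ A ∈ sepCuts X κ In, ∀ B ∈ sepCuts X κ In,
      (crossSet X κ In A).ncard + (crossSet X κ In B).ncard <
        (crossSet X κ In C).ncard + (crossSet X κ In D).ncard →
      SeparatesPoints X In A i j → SeparatesPoints X In B i j →
      (crossSet X κ In C).ncard < (crossSet X κ In D).ncard := by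
    intro A hA B hB hlt h h'
    have := oC A hA h
    have := oC B hB h'
    omega
  have finD : ∀ A ∈ sepCuts X κ In, ∀ B ∈ sepCuts X κ In,
      (crossSet X κ In A).ncard + (crossSet X κ In B).ncard <
        (crossSet X κ In C).ncard + (crossSet X κ In D).ncard →
      SeparatesPoints X In A k l → SeparatesPoints X In B k l →
      (crossSet X κ In D).ncard < (crossSet X κ In C).ncard := by
    intro A hA B hB hlt h h'
    have := oD A hA h
    have := oD B hB h'
    omega
  -- If `D` also separates `i` and `j`, both uncrossed cuts separate this pair, so `2μ(C) ≤ μ(A) +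
  -- μ(B) < μ(C) + μ(D)`. The claim `ltD` is the mirror image, and the two are incompatible.
  have ltC : ¬ (In D i ↔ In D j) → (crossSet X κ In C).ncard < (crossSet X κ In D).ncard := by
    intro h
    by_cases pi : In D i
    · obtain ⟨A, hA, B, hB, hlt, hp, hq, h1, h2⟩ := H1 i j hi pi hj (dDj.2 fun h' => h ⟨fun _ => h', fun _ => pi⟩)
      exact finC A hA B hB hlt (Or.inl ⟨hp, h1 j (Or.inl hj)⟩) (Or.inr ⟨hq, h2 i (Or.inl hi)⟩)
    · obtain ⟨A, hA, B, hB, hlt, hp, hq, h1, h2⟩ := H2 i j hi (dDi.2 pi) hj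
        (by_contra fun h' => h ⟨fun a => absurd a pi, fun a => absurd a h'⟩)
      exact finC A hA B hB hlt (Or.inl ⟨hp, h1 j (Or.inl hj)⟩) (Or.inr ⟨hq, h2 i (Or.inl hi)⟩)
  have ltD : ¬ (In C k ↔ In C l) → (crossSet X κ In D).ncard < (crossSet X κ In C).ncard := by
    intro h
    by_cases pk : In C k
    · obtain ⟨A, hA, B, hB, hlt, hp, hq, h1, h2⟩ := H1 k l pk hk
        (dCl.2 fun h' => h ⟨fun _ => h', fun _ => pk⟩) hl
      exact finD A hA B hB hlt (Or.inl ⟨hp, h1 l (Or.inr hl)⟩) (Or.inr ⟨hq, h2 k (Or.inr hk)⟩)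
    · obtain ⟨A, hA, B, hB, hlt, hp, hq, h1, h2⟩ := H2 l k
        (by_contra fun h' => h ⟨fun a => absurd a pk, fun a => absurd a h'⟩) hl (dCk.2 pk) hk
      exact finD A hA B hB hlt (Or.inr ⟨hp, h1 k (Or.inr hk)⟩) (Or.inl ⟨hq, h2 l (Or.inr hl)⟩)
  by_cases opp : ¬ (In D i ↔ In D j) ∧ ¬ (In C k ↔ In C l)
  · have := ltC opp.1
    have := ltD opp.2
    omega
  -- With a point of each pair in opposite corners, one uncrossed cut separates `i, j` and the other
  -- `k, l`: each isolates its point from everything on the opposite sides of `C` and `D`. Hence the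
  -- sum is at least `μ(C) + μ(D)`. The next three claims treat the other corners.
  have close1 : In D i → In (starCompl X C) l → False := by
    intro pi pl
    obtain ⟨A, hA, B, hB, hlt, hp, hq, h1, h2⟩ := H1 i l hi pi pl hl
    exact (fin A hA B hB hlt).1 ⟨Or.inl ⟨hp, h1 j (Or.inl hj)⟩, Or.inr ⟨hq, h2 k (Or.inr hk)⟩⟩
  have close2 : In C k → In (starCompl X D) j → False := by
    intro pk pj
    obtain ⟨A, hA, B, hB, hlt, hp, hq, h1, h2⟩ := H1 k j pk hk hj pj
    exact (fin A hA B hB hlt).2 ⟨Or.inl ⟨hp, h1 l (Or.inr hl)⟩, Or.inr ⟨hq, h2 i (Or.inl hi)⟩⟩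
  have close3 : In (starCompl X D) i → In (starCompl X C) k → False := by
    intro pi pk
    obtain ⟨A, hA, B, hB, hlt, hp, hq, h1, h2⟩ := H2 i k hi pi pk hk
    exact (fin A hA B hB hlt).1 ⟨Or.inl ⟨hp, h1 j (Or.inl hj)⟩, Or.inl ⟨hq, h2 l (Or.inr hl)⟩⟩
  have close4 : In C l → In D j → False := by
    intro pl pj
    obtain ⟨A, hA, B, hB, hlt, hp, hq, h1, h2⟩ := H2 l j pl hl hj pj
    exact (fin A hA B hB hlt).2 ⟨Or.inr ⟨hp, h1 k (Or.inr hk)⟩, Or.inr ⟨hq, h2 i (Or.inl hi)⟩⟩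
  -- Excluding these four configurations forces `D` to separate `i, j` and `C` to separate `k, l`,
  -- which `opp` forbids.
  by_cases pi : In D i
  · have pl : In C l := by_contra fun h => close1 pi (dCl.2 h)
    have pj : ¬ In D j := close4 pl
    have pk : ¬ In C k := fun h => close2 h (dDj.2 pj)
    exact opp ⟨fun h => pj (h.1 pi), fun h => pk (h.2 pl)⟩
  · have pk : In C k := by_contra fun h => close3 (dDi.2 pi) (dCk.2 h)
    have pj : In D j := by_contra fun h => close2 pk (dDj.2 h)
    have pl : ¬ In C l := fun h => close4 h pj
    exact opp ⟨fun h => pi (h.2 pj), fun h => pl (h.1 pk)⟩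

theorem IsProfile.links_empty_of_not_crosses (hP : IsProfile X κ In) (hC : IsSep X κ In C)
    (hD : IsSep X κ In D) (h : ¬ Crosses X C D) (h1 : In C i) (h2 : In D i)
    (h3 : In (starCompl X C) j) (h4 : In (starCompl X D) j) :
    (C ∩ boundary X D = ∅ ∧ starCompl X D ∩ boundary X C = ∅) ∨
      (D ∩ boundary X C = ∅ ∧ starCompl X C ∩ boundary X D = ∅) := by
  obtain ⟨a, b, -⟩ := hP.links_eq hC hD h1 h2 h3 h4
  have e (S T : Set V) (hT : IsSep X κ In T) : S ∩ boundary X T = ∅ ↔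
      (S ∩ boundary X T).ncard = 0 := by
    rw [Set.ncard_eq_zero (hT.finite.subset inter_subset_right)]
  simp only [Crosses, nonempty_iff_ne_empty, ne_eq] at h
  simp only [e _ _ hC, e _ _ hD] at h ⊢
  omega

/-- Three disjoint separators with the same boundary restrict the separators that cross them. -/
theorem IsProfile.not_crosses_three (hP : IsProfile X κ In) (hp : IsSep X κ In P)
    (hq : IsSep X κ In Q) (hr : IsSep X κ In R) (hE : IsSep X κ In E)
    (hQ : boundary X Q = boundary X P) (hR : boundary X R = boundary X P) (hPQ : Disjoint P Q)
    (hPR : Disjoint P R) (hQR : Disjoint Q R) (h1 : In P i) (h2 : In E i) (h3 : In Q j)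
    (h4 : In (starCompl X E) j) : ¬ Crosses X P E := by
  intro h
  obtain ⟨x, hx, hxE⟩ := ((hP.crosses_congr hp hr hE hR).2 h).1
  have f1 := hP.le_ncard_frame hp hE h1 h2
  have f2 := hP.le_ncard_frame hq (hP.isSep_starCompl hE) h3 h4
  obtain ⟨-, l2, l3, -⟩ := hP.links hp hE
  have l4 := (hP.links hq hE).2.2.2.1
  rw [hQ] at l4
  have f (S : Set V) : (S ∩ boundary X E).Finite := hE.finite.subset inter_subset_right
  have d1 : Disjoint (P ∩ boundary X E) (Q ∩ boundary X E) :=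
    hPQ.mono inter_subset_left inter_subset_left
  have d2 : Disjoint (P ∩ boundary X E ∪ Q ∩ boundary X E) (boundary X P ∩ boundary X E) := by
    rw [Set.disjoint_left]
    rintro v (hv | hv) hv'
    · exact hv'.1.1 hv.1
    · exact (hQ.symm ▸ hv'.1 : v ∈ boundary X Q).1 hv.1
  have c1 := ncard_union_eq d1 (f P) (f Q)
  have c2 := ncard_union_eq d2 ((f P).union (f Q)) (f _)
  have hsub : P ∩ boundary X E ∪ Q ∩ boundary X E ∪ boundary X P ∩ boundary X E ⊆
      boundary X E := by
    rintro v ((hv | hv) | hv) <;> exact hv.2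
  -- Adding the two frame bounds and subtracting `|NP| = κ` shows that `P`, `Q` and `NP` already
  -- contain all `κ` vertices of `NE`, leaving none for `R`.
  have heq := eq_of_subset_of_ncard_le hsub (by rw [hE.ncard]; omega) hE.finite
  rw [← heq] at hxE
  rcases hxE with (hv | hv) | hv
  · exact Set.disjoint_left.1 hPR hv.1 hx
  · exact Set.disjoint_left.1 hQR hv.1 hx
  · exact (hR.symm ▸ hv.1 : x ∈ boundary X R).1 hx

/-- The sets `D`, `P`, `Q` are disjoint with the same boundary. It remains to find points on
different sides of `E` in two disjoint sets with this boundary while a third such set is left over,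
as `not_crosses_three` requires. -/
theorem IsProfile.not_crosses_of_two_components (hP : IsProfile X κ In) (hD : IsSep X κ In D)
    (hE : IsSep X κ In E) (hP' : P ∈ sepCuts X κ In) (hQ' : Q ∈ sepCuts X κ In)
    (hp : IsComponent X (starCompl X D) P) (hq : IsComponent X (starCompl X D) Q) (hne : P ≠ Q) :
    ¬ Crosses X D E := by
  have bD := hP.boundary_starCompl hD
  have key : ∀ K ∈ sepCuts X κ In, IsComponent X (starCompl X D) K →
      boundary X K = boundary X D ∧ Disjoint D K := by
    intro K hK hKc
    obtain ⟨i, hi⟩ := hK.2.2.1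
    exact ⟨(hP.component_mem (hP.isSep_starCompl hD) hKc hi).2.trans bD,
      (disjoint_starCompl X D).mono_right hKc.subset⟩
  have main : ∀ E, IsSep X κ In E → ∀ i, In D i → In E i → ¬ Crosses X D E := by
    intro E hE i hiD hiE hX
    obtain ⟨j, hj⟩ := hE.2.2
    obtain ⟨bP, dP⟩ := key P hP' hp
    obtain ⟨bQ, dQ⟩ := key Q hQ' hq
    have dPQ := hp.disjoint_of_ne hq hne
    by_cases hjD : In D j
    · obtain ⟨k, hk⟩ := hP'.2.2.1
      by_cases hkE : In E k
      · exact hP.not_crosses_three hP'.2 hD hQ'.2 hE bP.symm (bQ.trans bP.symm) dP.symm dPQ dQ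
          hk hkE hjD hj ((hP.crosses_congr hD hP'.2 hE bP).2 hX)
      · exact hP.not_crosses_three hD hP'.2 hQ'.2 hE bP bQ dP dQ dPQ hiD hiE hk
          ((hP.star_iff' hE).2 hkE) hX
    · obtain ⟨K, hK, hKc, -, hKj⟩ := hP.exists_component_mem (hP.isSep_starCompl hD)
        ((hP.star_iff' hD).2 hjD)
      obtain ⟨bK, dK⟩ := key K hK hKc
      by_cases hKP : K = P
      · subst hKP
        exact hP.not_crosses_three hD hK.2 hQ'.2 hE bK bQ dK dQ dPQ hiD hiE hKj hj hX
      · exact hP.not_crosses_three hD hK.2 hP'.2 hE bK bP dK dP (hKc.disjoint_of_ne hp hKP)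
          hiD hiE hKj hj hX
  obtain ⟨i, hi⟩ := hD.2.1
  by_cases hiE : In E i
  · exact main E hE i hi hiE
  · rw [← hP.crosses_starCompl_right hD hE]
    exact main _ (hP.isSep_starCompl hE) i hi ((hP.star_iff' hE).2 hiE)

/-- A component of `D^*` that is a cut has boundary `ND`, hence the same `μ` as `D`. If it contains
the point `j` it is optimal for the pair of `D`; otherwise `D^*` has two components that are cuts,
so `μ = 0` and it is optimal for any pair it separates. -/
theorem IsProfile.component_mem_optimalCuts (hP : IsProfile X κ In) (hD : D ∈ optimalCuts X κ In)
    (hS : S = D ∨ S = starCompl X D) (hK : K ∈ sepCuts X κ In) (hKc : IsComponent X S K) :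
    K ∈ optimalCuts X κ In := by
  rcases hS with rfl | rfl
  · obtain ⟨x, hx⟩ := nonempty_of_induce_connected hK.1
    rwa [hKc.eq_of_mem (isComponent_self hD.1.1) hx (hKc.subset hx)]
  obtain ⟨i, j, hi, hj, hopt⟩ := hP.exists_optimal hD
  have hD' := hP.isSep_starCompl hD.1.2
  obtain ⟨L, hL, hLc, -, hLj⟩ := hP.exists_component_mem hD' hj
  obtain ⟨k, hk⟩ := hK.2.2.1
  have bK := (hP.component_mem hD' hKc hk).2.trans (hP.boundary_starCompl hD.1.2)
  have hcr := hP.crossSet_congr hD.1.2 hK.2 bK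
  refine ⟨hK, ?_⟩
  by_cases hKL : K = L
  · subst hKL
    refine ⟨i, j, Or.inr ⟨hLj, hP.mono ((subset_star_star X D).trans
      (starCompl_antitone hKc.subset)) hi⟩, fun A hA hs => ?_⟩
    rw [hP.mu_eq hK, hP.mu_eq hA, hcr]
    exact_mod_cast hopt A hA hs
  · obtain ⟨l, hl⟩ := hK.2.2.2
    refine ⟨k, l, Or.inl ⟨hk, hl⟩, fun A hA hs => ?_⟩
    have h0 : crossSet X κ In D = ∅ := eq_empty_iff_forall_notMem.2 fun E hE =>
      hP.not_crosses_of_two_components hD.1.2 hE.1.2 hK hL hKc hLc hKL hE.2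
    rw [hP.mu_eq hK, hcr, h0]
    simp

/-- As `S` and `T` do not cross, one of the two links of this corner is empty, so `K` is a component
of `S` or of `T`. -/
theorem IsProfile.corner_component_mem (hP : IsProfile X κ In) (hC : C ∈ optimalCuts X κ In)
    (hD : D ∈ optimalCuts X κ In) (hS : S = C ∨ S = starCompl X C)
    (hT : T = D ∨ T = starCompl X D) (hK : IsComponent X (S ∩ T) K) (hk : In K i)
    (h3 : In (starCompl X S) j) (h4 : In (starCompl X T) j) : K ∈ optimalCuts X κ In := by
  have hS' := hP.isSep_of_eq hC.1.2 hS
  have hT' := hP.isSep_of_eq hD.1.2 hT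
  have hn : ¬ Crosses X S T := by
    have h := hP.not_crosses_of_optimal hC hD
    rcases hS with rfl | rfl <;> rcases hT with rfl | rfl
    · exact h
    · rwa [hP.crosses_starCompl_right hC.1.2 hD.1.2]
    · rwa [hP.crosses_starCompl_left hC.1.2 hD.1.2]
    · rwa [hP.crosses_starCompl_right hS' hD.1.2, hP.crosses_starCompl_left hC.1.2 hD.1.2]
  have h1 := hP.mono (hK.subset.trans inter_subset_left) hk
  have h2 := hP.mono (hK.subset.trans inter_subset_right) hk
  have hmem := (hP.component_mem (hP.isSep_inter hS' hT' h1 h2 h3 h4).1 hK hk).1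
  rcases hP.links_empty_of_not_crosses hS' hT' hn h1 h2 h3 h4 with h | h
  · exact hP.component_mem_optimalCuts hC hS hmem (hK.of_inter h.1)
  · rw [inter_comm] at hK
    exact hP.component_mem_optimalCuts hD hT hmem (hK.of_inter h.1)

theorem IsProfile.isCutSystem_optimalCuts (hP : IsProfile X κ In) :
    IsCutSystem X (optimalCuts X κ In) := by
  have hcc : ∀ A, ContainsCut (optimalCuts X κ In) A → ∃ i, In A i := fun A h =>
    hP.exists_of_containsCut (h.imp fun E hE => ⟨hE.1.1, hE.2⟩)
  refine ⟨fun C hC => hC.1.1, fun C hC => hC.1.2.finite, fun C hC => hP.star_star hC.1.2, ?_, ?_⟩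
  · intro C hC D hD A B hO hA hB K hK hKc
    obtain ⟨S, T, hS, hT, rfl, rfl⟩ := hO.cases (hP.star_star hC.1.2) (hP.star_star hD.1.2)
    obtain ⟨k, hk⟩ := hcc _ hKc
    obtain ⟨j, hj⟩ := hcc _ hB
    exact hP.corner_component_mem hC hD hS hT hK hk (hP.mono inter_subset_left hj)
      (hP.mono inter_subset_right hj)
  · intro C hC D hD
    have key : ∀ S T : Set V, (S = C ∨ S = starCompl X C) → (T = D ∨ T = starCompl X D) → ∀ i j,
        In S i → In T i → In (starCompl X S) j → In (starCompl X T) j →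
        ContainsCut (optimalCuts X κ In) (S ∩ T) := by
      intro S T hS hT i j h1 h2 h3 h4
      obtain ⟨h, -, hi⟩ := hP.isSep_inter (hP.isSep_of_eq hC.1.2 hS) (hP.isSep_of_eq hD.1.2 hT)
        h1 h2 h3 h4
      obtain ⟨K, -, hKc, -, hKi⟩ := hP.exists_component_mem h hi
      exact ⟨K, hP.corner_component_mem hC hD hS hT hKc hKi h3 h4, hKc.subset⟩
    have sC := hP.star_star hC.1.2
    have sD := hP.star_star hD.1.2
    obtain ⟨i, j, ⟨h1, h2, h3, h4⟩ | ⟨h1, h2, h3, h4⟩⟩ := hP.exists_opposite hC.1.2 hD.1.2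
    · exact ⟨_, _, Or.inl ⟨rfl, rfl⟩, key _ _ (Or.inl rfl) (Or.inl rfl) i j h1 h2 h3 h4,
        key _ _ (Or.inr rfl) (Or.inr rfl) j i h3 h4 (sC.symm ▸ h1) (sD.symm ▸ h2)⟩
    · exact ⟨_, _, Or.inr (Or.inr (Or.inl ⟨rfl, rfl⟩)),
        key _ _ (Or.inl rfl) (Or.inr rfl) i j h1 h2 h3 (sD.symm ▸ h4),
        key _ _ (Or.inr rfl) (Or.inl rfl) j i h3 h4 (sC.symm ▸ h1) h2⟩

theorem IsProfile.nested_optimalCuts (hP : IsProfile X κ In) (hC : C ∈ optimalCuts X κ In)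
    (hD : D ∈ optimalCuts X κ In) : Nested X (sepCuts X κ In) C D :=
  (hP.nested_iff hC.1 hD.1).2 (hP.not_crosses_of_optimal hC hD)

theorem Nested.mono {𝒞 𝒟 : Set (Set V)} (h : 𝒟 ⊆ 𝒞) (hN : Nested X 𝒞 C D) : Nested X 𝒟 C D := by
  have key : ∀ S T : Set V, IsIsolatedCorner X 𝒞 C D S T → IsIsolatedCorner X 𝒟 C D S T :=
    fun S T hi => ⟨fun hc => hi.1 (hc.imp fun E hE => ⟨h hE.1, hE.2⟩), hi.2⟩
  exact hN.imp (key _ _) (Or.imp (key _ _) (Or.imp (key _ _) (key _ _)))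

end Optimal

end VertexCuts

namespace VertexCuts

variable {V : Type u} {X : SimpleGraph V} {A B C D K S T Y : Set V} {k : ℕ} {t : OmegaKind}

/-! ### Ends and inseparable sets form a profile -/

section OmegaProfile

theorem Ray.exists_component (r : Ray X) (h : r.EventuallyIn A) :
    ∃ K, IsComponent X A K ∧ r.EventuallyIn K := by
  obtain ⟨m, hm⟩ := eventually_atTop.1 h
  obtain ⟨K, hK, hmK⟩ := exists_isComponent (X := X) (hm m le_rfl)
  refine ⟨K, hK, eventually_atTop.2 ⟨m, fun n hn => ?_⟩⟩
  induction n, hn using Nat.le_induction with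
  | base => exact hmK
  | succ n hn ih =>
    by_contra hc
    exact Set.disjoint_left.1 hK.disjoint_boundary (hm (n + 1) (by omega)) ⟨hc, _, ih, r.adj n⟩

theorem Ray.EventuallyIn.mono {r : Ray X} (h : r.EventuallyIn A) (hAB : A ⊆ B) :
    r.EventuallyIn B :=
  Eventually.mono h fun _ hn => hAB hn

/-- Equivalence of rays only tests connected sets, so `A` is replaced by its component containing a
tail of `r`, whose boundary is again finite. -/
theorem Ray.eventuallyIn_congr {r s : Ray X} (hrs : (raySetoid X).r r s)
    (hA : (boundary X A).Finite) (h : r.EventuallyIn A) : s.EventuallyIn A := by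
  obtain ⟨K, hK, hr⟩ := r.exists_component h
  have hf := hA.subset hK.boundary_subset
  refine Ray.EventuallyIn.mono ?_ hK.subset
  exact (s.eventuallyIn_or K hf).resolve_right fun hs =>
    hrs K ⟨hK.connected, hf⟩ (Or.inl ⟨hr, hs⟩)

theorem VertexEnd.liesIn_mk {r : Ray X} (hA : (boundary X A).Finite) :
    VertexEnd.LiesIn (Quotient.mk (raySetoid X) r) A ↔ r.EventuallyIn A :=
  ⟨fun h => h r rfl, fun h _ hs =>
    Ray.eventuallyIn_congr ((raySetoid X).symm (Quotient.exact hs)) hA h⟩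

theorem VertexEnd.liesIn_starCompl_iff (e : VertexEnd X) (hA : (boundary X A).Finite) :
    e.LiesIn (starCompl X A) ↔ ¬ e.LiesIn A := by
  induction e using Quotient.inductionOn with
  | h r =>
    rw [VertexEnd.liesIn_mk hA,
      VertexEnd.liesIn_mk (hA.subset (boundary_starCompl_subset X A))]
    exact ⟨fun h h' => r.not_eventuallyIn_both A h' h, (r.eventuallyIn_or A hA).resolve_left⟩

theorem VertexEnd.exists_component (e : VertexEnd X) (hA : (boundary X A).Finite)
    (h : e.LiesIn A) : ∃ K, IsComponent X A K ∧ e.LiesIn K := by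
  induction e using Quotient.inductionOn with
  | h r =>
    obtain ⟨K, hK, hr⟩ := r.exists_component ((VertexEnd.liesIn_mk hA).1 h)
    exact ⟨K, hK, (VertexEnd.liesIn_mk (hA.subset hK.boundary_subset)).2 hr⟩

theorem VertexEnd.LiesIn.nonempty {e : VertexEnd X} (h : e.LiesIn A) : A.Nonempty := by
  induction e using Quotient.inductionOn with
  | h r =>
    obtain ⟨n, hn⟩ := (h r rfl).exists
    exact ⟨_, hn⟩

theorem IsInseparable.not_subset (hY : IsInseparable X k Y) (hS : S.encard ≤ k) : ¬ Y ⊆ S := by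
  intro h
  have h1 := (hY.1.trans (encard_le_encard h)).trans hS
  have h2 : k + 1 ≤ k := by exact_mod_cast h1
  omega

theorem IsInseparable.subset_of_mem (hY : IsInseparable X k Y) (hA : (boundary X A).encard ≤ k)
    {y : V} (hy : y ∈ Y) (hyA : y ∈ A) : Y ⊆ A ∪ boundary X A := by
  refine (hY.2 A hA).resolve_right fun h => ?_
  rw [starCompl_union_boundary] at h
  exact h hy hyA

theorem isInseparable_of_mem_omega (h : Sum.inr Y ∈ Omega X t k) : IsInseparable X k Y := by
  cases t with
  | ends => simp [Omega] at h
  | inseparable => simpa [Omega] using h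
  | both => simpa [Omega] using h

theorem IsInseparable.anti {m : ℕ} (hY : IsInseparable X k Y) (h : m ≤ k) :
    IsInseparable X m Y := by
  have hmk : (m : ℕ∞) ≤ k := by exact_mod_cast h
  refine ⟨le_trans ?_ hY.1, fun C hC => hY.2 C (hC.trans hmk)⟩
  exact_mod_cast Nat.succ_le_succ h

theorem omega_anti {m : ℕ} (h : m ≤ k) : Omega X t k ⊆ Omega X t m := by
  have hI : {Y | IsInseparable X k Y} ⊆ {Y | IsInseparable X m Y} := fun Y hY => hY.anti h
  cases t with
  | ends => exact Subset.rfl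
  | inseparable => exact image_mono hI
  | both => exact union_subset_union_right _ (image_mono hI)

variable {ω ω₁ ω₂ : VertexEnd X ⊕ Set V}

theorem finite_of_encard_le (h : S.encard ≤ k) : S.Finite :=
  finite_of_encard_le_coe h

/-- It does not matter whether the side `C^*` is taken with respect to `C` or to `C^*`. -/
theorem onSide_starCompl (hω : ω ∈ Omega X t k) (hA : (boundary X A).encard ≤ k) :
    OnSide X A (starCompl X A) ω ↔ OnSide X (starCompl X A) (starCompl X A) ω := by
  rcases ω with e | Y
  · exact Iff.rfl
  have hY := isInseparable_of_mem_omega hω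
  have hA' := (encard_le_encard (boundary_starCompl_subset X A)).trans hA
  constructor
  · rintro ⟨h1, h2⟩
    obtain ⟨y, hy, hyA⟩ := not_subset.1 h2
    exact ⟨hY.subset_of_mem hA' hy ((h1 hy).resolve_right hyA), hY.not_subset hA'⟩
  · rintro ⟨h1, -⟩
    exact ⟨h1.trans (union_subset_union_right _ (boundary_starCompl_subset X A)),
      hY.not_subset hA⟩

theorem onSide_starCompl_iff_not (hω : ω ∈ Omega X t k) (hA : (boundary X A).encard ≤ k) :
    OnSide X (starCompl X A) (starCompl X A) ω ↔ ¬ OnSide X A A ω := by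
  rcases ω with e | Y
  · exact e.liesIn_starCompl_iff (finite_of_encard_le hA)
  have hY := isInseparable_of_mem_omega hω
  rw [← onSide_starCompl hω hA]
  constructor
  · rintro ⟨h1, h2⟩ ⟨h3, -⟩
    obtain ⟨y, hy, hyA⟩ := not_subset.1 h2
    have h4 := (h1 hy).resolve_right hyA
    exact h4 (h3 hy)
  · intro h
    exact ⟨(hY.2 A hA).resolve_left fun h' => h ⟨h', hY.not_subset hA⟩, hY.not_subset hA⟩

theorem onSide_self_nonempty (h : OnSide X A A ω) : A.Nonempty := by
  rcases ω with e | Y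
  · exact VertexEnd.LiesIn.nonempty h
  · obtain ⟨y, hy, hyA⟩ := not_subset.1 h.2
    exact ⟨y, (h.1 hy).resolve_right hyA⟩

/-- A smaller separator of size `k` would contradict the choice of `κ`: the points also belong to
`Ω_k`, because inseparability passes to smaller `k`. -/
theorem kappa_le_boundary (hX : X.Connected) (h₁ : ω₁ ∈ Omega X t (kappa X t))
    (h₂ : ω₂ ∈ Omega X t (kappa X t)) (h : OnSide X A A ω₁)
    (h' : OnSide X (starCompl X A) (starCompl X A) ω₂) :
    (kappa X t : ℕ∞) ≤ (boundary X A).encard := by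
  by_contra! hlt
  have hfin : (boundary X A).Finite := finite_of_encard_le hlt.le
  obtain ⟨k, hk⟩ : ∃ k : ℕ, (boundary X A).encard = k := ⟨_, hfin.cast_ncard_eq.symm⟩
  have hlt' : k < kappa X t := by
    rw [hk] at hlt
    exact_mod_cast hlt
  refine Nat.notMem_of_lt_sInf hlt' ⟨?_, A, hk, ω₁, omega_anti hlt'.le h₁, ω₂,
    omega_anti hlt'.le h₂, Or.inl ⟨h, (onSide_starCompl h₂ hlt.le).2 h'⟩⟩
  -- Only positive `k` count in `kappa`; connectedness of `X` provides a boundary vertex.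
  obtain ⟨x, hx⟩ := onSide_self_nonempty h
  obtain ⟨y, hy⟩ := onSide_self_nonempty h'
  obtain ⟨p⟩ := hX.preconnected x y
  obtain ⟨v, -, hv⟩ := exists_mem_support_boundary p hx (mem_starCompl.1 hy).1
  rw [pos_iff_ne_zero]
  rintro rfl
  rw [Nat.cast_zero, encard_eq_zero] at hk
  exact (hk ▸ hv : v ∈ (∅ : Set V))

/-- The point `ω` of `Ω` lies in `A`. -/
def OmegaIn (X : SimpleGraph V) (t : OmegaKind) (A : Set V) (ω : Omega X t (kappa X t)) : Prop :=
  OnSide X A A ω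

theorem isProfile_omegaIn (hX : X.Connected) (t : OmegaKind) :
    IsProfile X (kappa X t) (OmegaIn X t) where
  mono := by
    rintro A B ⟨e | Y, hω⟩ hAB h
    · exact fun r hr => (h r hr).mono hAB
    · obtain ⟨h1, h2⟩ := h
      refine ⟨h1.trans (union_boundary_mono hAB), fun h3 => ?_⟩
      obtain ⟨y, hy, hyA⟩ := not_subset.1 h2
      exact (h3 hy).1 (hAB ((h1 hy).resolve_right hyA))
  star_iff := fun {A i} hA => onSide_starCompl_iff_not i.2 hA
  inter := by
    rintro A B ⟨e | Y, hω⟩ h h' hf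
    · exact fun r hr => (h r hr).and (h' r hr)
    · have hY := isInseparable_of_mem_omega hω
      have hsub : Y ⊆ A ∩ B ∪ frame X A B := inter_union_frame X A B ▸ subset_inter h.1 h'.1
      have hN := (encard_le_encard (boundary_inter_subset_frame X A B)).trans hf
      -- The frame is too small to contain `Y`, so some `y ∈ Y` lies in the corner itself, and
      -- inseparability takes the rest of `Y` along.
      obtain ⟨y, hy, hyF⟩ := not_subset.1 (hY.not_subset hf)
      exact ⟨hY.subset_of_mem hN hy ((hsub hy).resolve_right hyF), hY.not_subset hN⟩
  exists_component := by
    rintro A ⟨e | Y, hω⟩ hA h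
    · exact e.exists_component (finite_of_encard_le hA) h
    · have hY := isInseparable_of_mem_omega hω
      obtain ⟨y, hy, hyA⟩ := not_subset.1 h.2
      obtain ⟨K, hK, hyK⟩ := exists_isComponent (X := X) ((h.1 hy).resolve_right hyA)
      have hN := (encard_le_encard hK.boundary_subset).trans hA
      exact ⟨K, hK, hY.subset_of_mem hN hy hyK, hY.not_subset hN⟩
  minimal := fun {A i j} hi hj => kappa_le_boundary hX i.2 j.2 hi hj

theorem separates_iff {C : Set V} (hC : (boundary X C).encard ≤ kappa X t)
    (i j : Omega X t (kappa X t)) :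
    Separates X C i j ↔ SeparatesPoints X (OmegaIn X t) C i j := by
  unfold Separates SeparatesPoints OmegaIn
  rw [onSide_starCompl i.2 hC, onSide_starCompl j.2 hC]

/-- The condition `A^** = A` is automatic for separators of size `κ`, by `IsProfile.star_star`. -/
theorem omegaCuts_eq (hX : X.Connected) (t : OmegaKind) :
    omegaCuts X t = sepCuts X (kappa X t) (OmegaIn X t) := by
  ext C
  constructor
  · rintro ⟨h1, -, h3, ω₁, h₁, ω₂, h₂, hs⟩
    rcases (separates_iff h3.le ⟨ω₁, h₁⟩ ⟨ω₂, h₂⟩).1 hs with h | h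
    · exact ⟨h1, h3, ⟨_, h.1⟩, ⟨_, h.2⟩⟩
    · exact ⟨h1, h3, ⟨_, h.1⟩, ⟨_, h.2⟩⟩
  · intro hC
    obtain ⟨i, hi⟩ := hC.2.2.1
    obtain ⟨j, hj⟩ := hC.2.2.2
    exact ⟨hC.1, (isProfile_omegaIn hX t).star_star hC.2, hC.2.1, i, i.2, j, j.2,
      (separates_iff hC.2.1.le i j).2 (Or.inl ⟨hi, hj⟩)⟩

theorem canonicalCuts_eq (hX : X.Connected) (t : OmegaKind) :
    canonicalCuts X t = optimalCuts X (kappa X t) (OmegaIn X t) := by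
  have hs : ∀ C ∈ sepCuts X (kappa X t) (OmegaIn X t), ∀ i j : Omega X t (kappa X t),
      Separates X C i j ↔ SeparatesPoints X (OmegaIn X t) C i j :=
    fun C hC i j => separates_iff hC.2.1.le i j
  ext C
  unfold canonicalCuts IsOptimallyNested
  rw [omegaCuts_eq hX t]
  constructor
  · rintro ⟨ω₁, h₁, ω₂, h₂, hC, hsep, hopt⟩
    exact ⟨hC, ⟨ω₁, h₁⟩, ⟨ω₂, h₂⟩, (hs C hC _ _).1 hsep,
      fun D hD h => hopt D hD ((hs D hD ⟨ω₁, h₁⟩ ⟨ω₂, h₂⟩).2 h)⟩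
  · rintro ⟨hC, i, j, hsep, hopt⟩
    exact ⟨i, i.2, j, j.2, hC, (hs C hC i j).2 hsep,
      fun D hD h => hopt D hD ((hs D hD i j).1 h)⟩

/-- A separating cut with minimal `μ` exists because `ℕ∞` is well-ordered; finiteness of `μ` plays
no role here. -/
theorem exists_canonicalCuts (h₁ : ω₁ ∈ Omega X t (kappa X t))
    (h₂ : ω₂ ∈ Omega X t (kappa X t)) (h : ∃ C ∈ omegaCuts X t, Separates X C ω₁ ω₂) :
    ∃ C ∈ canonicalCuts X t, Separates X C ω₁ ω₂ := by
  obtain ⟨C, ⟨hC, hs⟩, hmin⟩ := exists_minimalFor_of_wellFoundedLT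
    (fun C => C ∈ omegaCuts X t ∧ Separates X C ω₁ ω₂) (mu X (omegaCuts X t)) h
  exact ⟨C, ⟨ω₁, h₁, ω₂, h₂, hC, hs, fun D hD hs' =>
    (le_total _ _).elim id fun hle => hmin ⟨hD, hs'⟩ hle⟩, hs⟩

end OmegaProfile

/-! ### Invariance under isomorphisms -/

section Isomorphism

variable {W : Type u} {Z : SimpleGraph W}

/-- Sets are transported by preimages, which commute with complements, unions and intersections;
images appear only at the end, through the inverse isomorphism. -/
theorem boundary_preimage (f : X ≃g Z) (D : Set W) :
    boundary X (f ⁻¹' D) = f ⁻¹' boundary Z D := by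
  ext v
  constructor
  · rintro ⟨hv, w, hw, hwv⟩
    exact ⟨hv, f w, hw, f.map_adj_iff.2 hwv⟩
  · rintro ⟨hv, w, hw, hwv⟩
    refine ⟨hv, f.symm w, by simpa using hw, ?_⟩
    rw [← f.map_adj_iff]
    simpa using hwv

theorem starCompl_preimage (f : X ≃g Z) (D : Set W) :
    starCompl X (f ⁻¹' D) = f ⁻¹' starCompl Z D := by
  rw [starCompl, boundary_preimage, starCompl, preimage_compl, preimage_union]

theorem encard_preimage (f : X ≃g Z) (D : Set W) : (f ⁻¹' D).encard = D.encard :=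
  encard_preimage_of_bijective f.bijective D

theorem connected_preimage (f : X ≃g Z) {D : Set W} (h : (Z.induce D).Connected) :
    (X.induce (f ⁻¹' D)).Connected := by
  let e : X.induce (f ⁻¹' D) ≃g Z.induce D :=
    { toEquiv := f.toEquiv.subtypeEquiv fun _ => Iff.rfl
      map_rel_iff' := f.map_adj_iff }
  exact e.connected_iff.2 h

/-- The image of a ray under an isomorphism. -/
def Ray.map (f : X ≃g Z) (r : Ray X) : Ray Z where
  toFun n := f (r.toFun n)
  injective := f.injective.comp r.injective
  adj n := f.map_adj_iff.2 (r.adj n)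

theorem Ray.map_map_symm (f : X ≃g Z) (r : Ray Z) : (r.map f.symm).map f = r := by
  cases r
  simp [Ray.map]

theorem Ray.map_equiv (f : X ≃g Z) {r s : Ray X} (h : (raySetoid X).r r s) :
    (raySetoid Z).r (r.map f) (s.map f) := by
  intro D hD hs
  refine h (f ⁻¹' D) ⟨connected_preimage f hD.1, ?_⟩ ?_
  · rw [boundary_preimage]
    exact hD.2.preimage f.injective.injOn
  · unfold SeparatesRays
    rw [starCompl_preimage]
    exact hs

/-- The image of a vertex end under an isomorphism. -/
def VertexEnd.map (f : X ≃g Z) : VertexEnd X → VertexEnd Z :=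
  Quotient.map (sa := raySetoid X) (sb := raySetoid Z) (Ray.map f) fun _ _ h => Ray.map_equiv f h

theorem VertexEnd.map_map_symm (f : X ≃g Z) (e : VertexEnd Z) :
    (e.map f.symm).map f = e := by
  induction e using Quotient.inductionOn with
  | h r => exact congrArg (Quotient.mk (raySetoid Z)) (Ray.map_map_symm f r)

theorem VertexEnd.map_symm_map (f : X ≃g Z) (e : VertexEnd X) :
    (e.map f).map f.symm = e :=
  VertexEnd.map_map_symm f.symm e

theorem VertexEnd.map_liesIn (f : X ≃g Z) (e : VertexEnd X) (D : Set W) :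
    (e.map f).LiesIn D ↔ e.LiesIn (f ⁻¹' D) := by
  constructor
  · rintro h r rfl
    exact h (r.map f) rfl
  · intro h r hr
    rw [← Ray.map_map_symm f r]
    refine h (r.map f.symm) ?_
    rw [← VertexEnd.map_symm_map f e, ← hr]
    rfl

/-- The image of an end or of a set of vertices under an isomorphism. -/
def omegaMap (f : X ≃g Z) : VertexEnd X ⊕ Set V → VertexEnd Z ⊕ Set W :=
  Sum.map (VertexEnd.map f) (fun Y => f '' Y)

theorem omegaMap_map_symm (f : X ≃g Z) (ω : VertexEnd Z ⊕ Set W) :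
    omegaMap f (omegaMap f.symm ω) = ω := by
  rcases ω with e | Y
  · exact congrArg Sum.inl (VertexEnd.map_map_symm f e)
  · refine congrArg Sum.inr ?_
    change f '' (f.symm '' Y) = Y
    rw [← image_comp]
    have hid : (f ∘ f.symm : W → W) = id := by
      ext v
      simp
    rw [hid, image_id]

theorem onSide_omegaMap (f : X ≃g Z) (D S : Set W) (ω : VertexEnd X ⊕ Set V) :
    OnSide Z D S (omegaMap f ω) ↔ OnSide X (f ⁻¹' D) (f ⁻¹' S) ω := by
  rcases ω with e | Y
  · exact VertexEnd.map_liesIn f e S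
  · change f '' Y ⊆ S ∪ boundary Z D ∧ ¬ f '' Y ⊆ boundary Z D ↔ _
    rw [image_subset_iff, image_subset_iff, preimage_union, ← boundary_preimage]
    rfl

theorem separates_omegaMap (f : X ≃g Z) (D : Set W) (ω₁ ω₂ : VertexEnd X ⊕ Set V) :
    Separates Z D (omegaMap f ω₁) (omegaMap f ω₂) ↔ Separates X (f ⁻¹' D) ω₁ ω₂ := by
  simp only [Separates, onSide_omegaMap, starCompl_preimage]

theorem IsInseparable.image (f : X ≃g Z) (hY : IsInseparable X k Y) :
    IsInseparable Z k (f '' Y) := by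
  refine ⟨by rw [f.injective.encard_image]; exact hY.1, fun D hD => ?_⟩
  have h := hY.2 (f ⁻¹' D) (by rwa [boundary_preimage, encard_preimage])
  rw [boundary_preimage, starCompl_preimage, ← preimage_union, ← preimage_union] at h
  rwa [image_subset_iff, image_subset_iff]

theorem omegaMap_mem (f : X ≃g Z) {ω : VertexEnd X ⊕ Set V} (hω : ω ∈ Omega X t k) :
    omegaMap f ω ∈ Omega Z t k := by
  rcases ω with e | Y
  · cases t <;> simp_all [Omega, omegaMap]
  · have h := (isInseparable_of_mem_omega hω).image f
    cases t <;> simp_all [Omega, omegaMap]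

theorem exists_separates_preimage (f : X ≃g Z) {D : Set W}
    (h : ∃ ω₁ ∈ Omega Z t k, ∃ ω₂ ∈ Omega Z t k, Separates Z D ω₁ ω₂) :
    ∃ ω₁ ∈ Omega X t k, ∃ ω₂ ∈ Omega X t k, Separates X (f ⁻¹' D) ω₁ ω₂ := by
  obtain ⟨ω₁, h₁, ω₂, h₂, hs⟩ := h
  refine ⟨_, omegaMap_mem f.symm h₁, _, omegaMap_mem f.symm h₂, ?_⟩
  rwa [← separates_omegaMap, omegaMap_map_symm, omegaMap_map_symm]

theorem kappa_congr (f : X ≃g Z) (t : OmegaKind) : kappa X t = kappa Z t := by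
  unfold kappa
  congr 1
  ext k
  refine and_congr_right fun _ => ⟨?_, ?_⟩
  · rintro ⟨C, hC, h⟩
    exact ⟨f.symm ⁻¹' C, by rwa [boundary_preimage, encard_preimage],
      exists_separates_preimage f.symm h⟩
  · rintro ⟨C, hC, h⟩
    exact ⟨f ⁻¹' C, by rwa [boundary_preimage, encard_preimage], exists_separates_preimage f h⟩

theorem preimage_mem_omegaCuts (f : X ≃g Z) {D : Set W} (h : D ∈ omegaCuts Z t) :
    f ⁻¹' D ∈ omegaCuts X t := by
  obtain ⟨h1, h2, h3, h4⟩ := h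
  rw [← kappa_congr f t] at h3 h4
  refine ⟨connected_preimage f h1, ?_, ?_, exists_separates_preimage f h4⟩
  · rw [starCompl_preimage, starCompl_preimage, h2]
  · rw [boundary_preimage, encard_preimage, h3]

theorem preimage_symm_preimage (f : X ≃g Z) (D : Set W) : f.symm ⁻¹' (f ⁻¹' D) = D := by
  ext v
  simp

theorem preimage_preimage_symm (f : X ≃g Z) (C : Set V) : f ⁻¹' (f.symm ⁻¹' C) = C := by
  ext v
  simp

theorem containsCut_preimage (f : X ≃g Z) (A : Set W) :
    ContainsCut (omegaCuts X t) (f ⁻¹' A) ↔ ContainsCut (omegaCuts Z t) A := by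
  constructor
  · rintro ⟨E, hE, hEA⟩
    refine ⟨f.symm ⁻¹' E, preimage_mem_omegaCuts f.symm hE, ?_⟩
    rw [← preimage_symm_preimage f A]
    exact preimage_mono hEA
  · rintro ⟨E, hE, hEA⟩
    exact ⟨f ⁻¹' E, preimage_mem_omegaCuts f hE, preimage_mono hEA⟩

theorem preimage_iso_eq_empty_iff (f : X ≃g Z) (A : Set W) : f ⁻¹' A = ∅ ↔ A = ∅ := by
  rw [← encard_eq_zero, encard_preimage, encard_eq_zero]

theorem nested_preimage (f : X ≃g Z) (C D : Set W) :
    Nested X (omegaCuts X t) (f ⁻¹' C) (f ⁻¹' D) ↔ Nested Z (omegaCuts Z t) C D := by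
  simp only [Nested, IsIsolatedCorner, starCompl_preimage, boundary_preimage, ← preimage_inter,
    containsCut_preimage, preimage_iso_eq_empty_iff]

theorem mu_preimage (f : X ≃g Z) (D : Set W) :
    mu X (omegaCuts X t) (f ⁻¹' D) = mu Z (omegaCuts Z t) D := by
  unfold mu
  rw [← f.surjective.preimage_injective.encard_image]
  congr 1
  ext E
  constructor
  · rintro ⟨h1, h2⟩
    refine ⟨f.symm ⁻¹' E, ⟨preimage_mem_omegaCuts f.symm h1, ?_⟩, preimage_preimage_symm f E⟩
    rwa [← nested_preimage f, preimage_preimage_symm]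
  · rintro ⟨E, ⟨h1, h2⟩, rfl⟩
    exact ⟨preimage_mem_omegaCuts f h1, by rwa [nested_preimage]⟩

theorem preimage_mem_canonicalCuts (f : X ≃g Z) {D : Set W} (h : D ∈ canonicalCuts Z t) :
    f ⁻¹' D ∈ canonicalCuts X t := by
  obtain ⟨ω₁, h₁, ω₂, h₂, hD, hs, hopt⟩ := h
  rw [← kappa_congr f t] at h₁ h₂
  refine ⟨_, omegaMap_mem f.symm h₁, _, omegaMap_mem f.symm h₂, preimage_mem_omegaCuts f hD, ?_,
    fun E hE hsE => ?_⟩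
  · rwa [← separates_omegaMap, omegaMap_map_symm, omegaMap_map_symm]
  · have hE' := preimage_mem_omegaCuts f.symm hE
    rw [← preimage_preimage_symm f E] at hsE ⊢
    rw [← separates_omegaMap, omegaMap_map_symm, omegaMap_map_symm] at hsE
    rw [mu_preimage, mu_preimage]
    exact hopt _ hE' hsE

theorem image_canonicalCuts (f : X ≃g Z) :
    (fun C : Set V => f '' C) '' canonicalCuts X t = canonicalCuts Z t := by
  apply Subset.antisymm
  · rintro _ ⟨C, hC, rfl⟩
    have h := preimage_mem_canonicalCuts f.symm hC
    rwa [← image_preimage_eq (f.symm ⁻¹' C) f.surjective, preimage_preimage_symm] at h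
  · intro D hD
    exact ⟨f ⁻¹' D, preimage_mem_canonicalCuts f hD, image_preimage_eq D f.surjective⟩

end Isomorphism

end VertexCuts

/-! ### The main theorem -/

theorem theorem8p6 {V : Type u} (X : SimpleGraph V) (hX : X.Connected)
    (t : VertexCuts.OmegaKind) :
    VertexCuts.IsThinCutSystem X (VertexCuts.omegaCuts X t) ∧
    VertexCuts.canonicalCuts X t ⊆ VertexCuts.omegaCuts X t ∧
    VertexCuts.IsNestedCutSystem X (VertexCuts.canonicalCuts X t) ∧
    (∀ C ∈ VertexCuts.canonicalCuts X t, ∀ D ∈ VertexCuts.canonicalCuts X t,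
      VertexCuts.Nested X (VertexCuts.omegaCuts X t) C D) ∧
    (∀ g : X ≃g X, (fun C : Set V => g '' C) '' VertexCuts.canonicalCuts X t =
      VertexCuts.canonicalCuts X t) ∧
    (∀ {W : Type u} (Y : SimpleGraph W) (f : X ≃g Y),
      (fun C : Set V => f '' C) '' VertexCuts.canonicalCuts X t =
        VertexCuts.canonicalCuts Y t) ∧
    (∀ ω₁ ∈ VertexCuts.Omega X t (VertexCuts.kappa X t),
      ∀ ω₂ ∈ VertexCuts.Omega X t (VertexCuts.kappa X t),
      (∃ C ∈ VertexCuts.omegaCuts X t, VertexCuts.Separates X C ω₁ ω₂) →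
      ∃ C ∈ VertexCuts.canonicalCuts X t, VertexCuts.Separates X C ω₁ ω₂) := by
  have hP := VertexCuts.isProfile_omegaIn hX t
  have hnest : ∀ C ∈ VertexCuts.canonicalCuts X t, ∀ D ∈ VertexCuts.canonicalCuts X t,
      VertexCuts.Nested X (VertexCuts.omegaCuts X t) C D := by
    rw [VertexCuts.canonicalCuts_eq hX, VertexCuts.omegaCuts_eq hX]
    exact fun C hC D hD => hP.nested_optimalCuts hC hD
  have hsub : VertexCuts.canonicalCuts X t ⊆ VertexCuts.omegaCuts X t := by
    rintro C ⟨ω₁, -, ω₂, -, hC, -⟩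
    exact hC
  refine ⟨?_, hsub, ⟨?_, fun C hC D hD => (hnest C hC D hD).mono hsub⟩, hnest,
    fun g => VertexCuts.image_canonicalCuts g, fun Y f => VertexCuts.image_canonicalCuts f,
    fun ω₁ h₁ ω₂ h₂ h => VertexCuts.exists_canonicalCuts h₁ h₂ h⟩
  · rw [VertexCuts.omegaCuts_eq hX]
    exact hP.isThinCutSystem
  · rw [VertexCuts.canonicalCuts_eq hX]
    exact hP.isCutSystem_optimalCuts
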